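/- Let $\mathbb{K}$ be $\mathbb{R}$ or $\mathbb{C}$; all normed spaces and algebras are over $\mathbb{K}$, and operators are bounded and linear. For a family $(F_\gamma)_{\gamma\in\Gamma}$ of Banach spaces, $(\bigoplus_\gamma F_\gamma)_{c_0}$ is the space of families $x=(x_\gamma)$ with $x_\gamma\in F_\gamma$ such that $\{\gamma:\|x_\gamma\|\ge\varepsilon\}$ is finite for each $\varepsilon>0$, with norm $\sup_\gamma\|x_\gamma\|$, and $(\bigoplus_\gamma F_\gamma)_{\ell_1}$ is the space of families with $\|x\|=\sum_\gamma\|x_\gamma\|<\infty$. Put $c_0(\Gamma)=(\bigoplus_{\gamma\in\Gamma}\mathbb{K})_{c_0}$, $\ell_1(\Gamma)=(\bigoplus_{\gamma\in\Gamma}\mathbb{K})_{\ell_1}$, $c_0=c_0(\mathbb{N})$ and $\ell_1=\ell_1(\mathbb{N})$. For Banach spaces $X,Y$, let $\mathscr{K}(X,Y)$ be the compact operators in the space $\mathscr{B}(X,Y)$ of operators $X\to Y$; the essential norm of $T\in\mathscr{B}(X,Y)$ is the quotient norm $\|T\|_e=\|T+\mathscr{K}(X,Y)\|$, and the Calkin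 algebra of $X$ is $\mathscr{B}(X)/\mathscr{K}(X)$ with the quotient norm, where $\mathscr{B}(X)=\mathscr{B}(X,X)$ and $\mathscr{K}(X)=\mathscr{K}(X,X)$. A normed algebra $\mathscr{A}$ has the $C$-IFP (idempotent factorization property with constant $C\ge1$) if for every $a\in\mathscr{A}$ with $\|a\|=1$ there are $b,c\in\mathscr{A}$ with $\|b\|\,\|c\|\le C$ such that $bac$ is a non-zero idempotent. It is uniformly incompressible if there is a function $f\colon(0,\infty)\to(0,\infty)$ such that every continuous, injective homomorphism $\varphi$ from $\mathscr{A}$ into a normed algebra satisfies $\|\varphi(a)\|\ge f(\|\varphi\|)\,\|a\|$ for all $a\in\mathscr{A}$. Let $E=c_0$ or $E=\ell_1$. (1) Let $X=(\bigoplus_{\gamma\in\Gamma}F_\gamma)_E$ and $Y=(\bigoplus_{\xi\in\Xi}G_\xi)_E$, where $\Gamma$ and $\Xi$ are infinite sets and all $F_\gamma$ and $G_\xi$ are non-zero, finite-dimensional Banach spaces. Then, for every non-compact $T\in\mathscr{B}(X,Y)$ with $\|T\|_e=1$ and every constant $C>1$, there are operators $U\in\mathscr{B}(Y,E)$ and $V\in\mathscr{B}(E,X)$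 such that $UTV=I_E$ and $\|U\|\,\|V\|\le C$. (2) Let $\Gamma$ be any set (possibly empty), and let $E_\Gamma=c_0(\Gamma)$ if $E=c_0$ and $E_\Gamma=\ell_1(\Gamma)$ if $E=\ell_1$. Let $X=(\bigoplus_{n\ge1}\ell_2^n)_E\oplus E_\Gamma$, normed by $\|(x,y)\|=\max\{\|x\|,\|y\|\}$ if $E=c_0$ and by $\|(x,y)\|=\|x\|+\|y\|$ if $E=\ell_1$. Then, for every non-compact $T\in\mathscr{B}(X)$ with $\|T\|_e=1$ and every constant $C>1$, there are operators $U\in\mathscr{B}(X,E)$ and $V\in\mathscr{B}(E,X)$ such that $UTV=I_E$ and $\|U\|\,\|V\|\le C$. Consequently the Calkin algebra of $X$ has the $C$-IFP for every $C>1$ and is uniformly incompressible. -/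

import Mathlib

open scoped ENNReal

noncomputable section

namespace CalkinIFP

/-! ### The direct sums -/

section DirectSums

variable (𝕜 : Type*) [RCLike 𝕜] {ι : Type*} (G : ι → Type*)
  [∀ i, NormedAddCommGroup (G i)] [∀ i, NormedSpace 𝕜 (G i)]

/-- The families `(x i)` in the bounded product of the `G i` for which `{i | ε ≤ ‖x i‖}` is finite
for each `ε > 0`. -/
def c0Submodule : Submodule 𝕜 (lp G ∞) where
  carrier := {x | ∀ ε : ℝ, 0 < ε → {i | ε ≤ ‖x i‖}.Finite}
  add_mem' := by
    intro x y hx hy ε hε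
    refine ((hx (ε / 2) (by positivity)).union (hy (ε / 2) (by positivity))).subset ?_
    intro i hi
    simp only [Set.mem_ofPred_eq, Set.mem_union, lp.coeFn_add, Pi.add_apply] at hi ⊢
    by_contra! h
    linarith [norm_add_le (x i) (y i), h.1, h.2]
  zero_mem' := by
    intro ε hε
    convert Set.finite_empty
    ext i
    simpa using hε
  smul_mem' := by
    intro c x hx ε hε
    refine (hx (ε / (‖c‖ + 1)) (by positivity)).subset ?_
    intro i hi
    simp only [Set.mem_ofPred_eq, lp.coeFn_smul, Pi.smul_apply, norm_smul] at hi ⊢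
    rw [div_le_iff₀ (by positivity)]
    nlinarith [norm_nonneg (x i), norm_nonneg c]

/-- The `c₀`-direct sum of a family of normed spaces, with the supremum norm. -/
abbrev C0Sum : Type _ := c0Submodule 𝕜 G

/-- The `ℓ₁`-direct sum of a family of normed spaces, with the norm `∑ ‖x i‖`. -/
abbrev L1Sum : Type _ := lp G 1

end DirectSums

section Completeness

variable {𝕜 : Type*} [RCLike 𝕜] {ι : Type*} {G : ι → Type*}
  [∀ i, NormedAddCommGroup (G i)] [∀ i, NormedSpace 𝕜 (G i)]

theorem isClosed_c0Submodule : IsClosed (c0Submodule 𝕜 G : Set (lp G ∞)) := by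
  refine isClosed_of_closure_subset fun x hx ε hε => ?_
  obtain ⟨y, hy, hxy⟩ := Metric.mem_closure_iff.1 hx (ε / 2) (by positivity)
  refine (hy (ε / 2) (by positivity)).subset ?_
  intro i hi
  simp only [Set.mem_ofPred_eq] at hi ⊢
  have h1 : ‖(x - y) i‖ ≤ ‖x - y‖ := lp.norm_apply_le_norm (by simp) (x - y) i
  rw [← dist_eq_norm] at h1
  have h2 : ‖x i‖ ≤ ‖(x - y) i‖ + ‖y i‖ := by
    simpa using norm_add_le ((x - y) i) (y i)
  linarith

instance [∀ i, CompleteSpace (G i)] : CompleteSpace (C0Sum 𝕜 G) :=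
  (isClosed_c0Submodule (𝕜 := 𝕜) (G := G)).completeSpace_coe

end Completeness

/-! ### Essential norm and factorization of an identity operator -/

section Factorization

/-- The norm of `T + K(X, Y)` in the quotient of `B(X, Y)` by the compact operators. -/
def essNorm {𝕜 X Y : Type*} [RCLike 𝕜] [NormedAddCommGroup X] [NormedSpace 𝕜 X]
    [NormedAddCommGroup Y] [NormedSpace 𝕜 Y] (T : X →L[𝕜] Y) : ℝ :=
  ‖(Submodule.Quotient.mk T : (X →L[𝕜] Y) ⧸ compactOperator (RingHom.id 𝕜) X Y)‖

/-- For every `C > 1`, the identity of `E` factors with constant `C` through every non-compact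
operator from `X` to `Y` of essential norm `1`. -/
def IdentityFactors (𝕜 E X Y : Type*) [RCLike 𝕜] [NormedAddCommGroup E] [NormedSpace 𝕜 E]
    [NormedAddCommGroup X] [NormedSpace 𝕜 X] [NormedAddCommGroup Y] [NormedSpace 𝕜 Y] : Prop :=
  ∀ T : X →L[𝕜] Y, ¬ IsCompactOperator T → essNorm T = 1 → ∀ C : ℝ, 1 < C →
    ∃ (U : Y →L[𝕜] E) (V : E →L[𝕜] X),
      U ∘L T ∘L V = ContinuousLinearMap.id 𝕜 E ∧ ‖U‖ * ‖V‖ ≤ C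

end Factorization

/-! ### The Calkin algebra -/

section Calkin

variable (𝕜 X : Type*) [RCLike 𝕜] [NormedAddCommGroup X] [NormedSpace 𝕜 X]

/-- The ideal of compact operators in the algebra of bounded operators on `X`. -/
def compactIdeal : Ideal (X →L[𝕜] X) where
  carrier := {T | IsCompactOperator T}
  add_mem' hS hT := hS.add hT
  zero_mem' := isCompactOperator_zero
  smul_mem' S _ hT := hT.clm_comp S

instance : (compactIdeal 𝕜 X).IsTwoSided :=
  ⟨fun {T} S (hT : IsCompactOperator T) => hT.comp_clm S⟩

instance [CompleteSpace X] : IsClosed (compactIdeal 𝕜 X : Set (X →L[𝕜] X)) :=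
  isClosed_setOfPred_isCompactOperator

/-- The Calkin algebra `B(X) / K(X)`, with the quotient norm. -/
abbrev Calkin : Type _ := (X →L[𝕜] X) ⧸ compactIdeal 𝕜 X

theorem Calkin.norm_mul_le' (a b : Calkin 𝕜 X) : ‖a * b‖ ≤ ‖a‖ * ‖b‖ := by
  have key : ∀ ε : ℝ, 0 < ε → ‖a * b‖ ≤ (‖a‖ + ε) * (‖b‖ + ε) := by
    intro ε hε
    obtain ⟨S, rfl, hS⟩ := Submodule.Quotient.norm_mk_lt a hε
    obtain ⟨T, rfl, hT⟩ := Submodule.Quotient.norm_mk_lt b hε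
    calc _ = ‖(Submodule.Quotient.mk (S * T) : Calkin 𝕜 X)‖ := rfl
      _ ≤ ‖S * T‖ := Submodule.Quotient.norm_mk_le _ _
      _ ≤ ‖S‖ * ‖T‖ := norm_mul_le S T
      _ ≤ _ := by gcongr
  have h1 : Filter.Tendsto (fun ε : ℝ => (‖a‖ + ε) * (‖b‖ + ε)) (nhdsWithin 0 (Set.Ioi 0))
      (nhds ((‖a‖ + 0) * (‖b‖ + 0))) :=
    (Continuous.tendsto (by fun_prop) 0).mono_left nhdsWithin_le_nhds
  have h2 := ge_of_tendsto h1 (eventually_nhdsWithin_of_forall key)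
  simpa using h2

instance [CompleteSpace X] : NormedRing (Calkin 𝕜 X) where
  __ := Ideal.Quotient.ring (compactIdeal 𝕜 X)
  __ := Submodule.Quotient.normedAddCommGroup (compactIdeal 𝕜 X)
  norm_mul_le := Calkin.norm_mul_le' 𝕜 X

instance [CompleteSpace X] : NormedAlgebra 𝕜 (Calkin 𝕜 X) where
  __ := Ideal.Quotient.algebra 𝕜 (I := compactIdeal 𝕜 X)
  norm_smul_le := (Submodule.Quotient.normedSpace (compactIdeal 𝕜 X) 𝕜).norm_smul_le

end Calkin

/-! ### Properties of normed algebras -/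

section NormedAlgebras

/-- The idempotent factorization property with constant `C`: for each `a` of norm `1` there are
`b`, `c` with `‖b‖ * ‖c‖ ≤ C` such that `b * a * c` is a non-zero idempotent. -/
def HasIFP (C : ℝ) (A : Type*) [NonUnitalNormedRing A] : Prop :=
  ∀ a : A, ‖a‖ = 1 → ∃ b c : A, ‖b‖ * ‖c‖ ≤ C ∧ b * a * c ≠ 0 ∧ IsIdempotentElem (b * a * c)

/-- Uniform incompressibility: there is `f : (0, ∞) → (0, ∞)` such that every continuous injective
homomorphism `φ` from `A` into a normed algebra is bounded below by `f ‖φ‖`. The norms of normed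
algebras are submultiplicative, and no identity element is required. -/
def UniformlyIncompressible.{w, u, v} (𝕜 : Type u) [RCLike 𝕜] (A : Type v)
    [NonUnitalNormedRing A] [NormedSpace 𝕜 A] : Prop :=
  ∃ f : ℝ → ℝ, (∀ t, 0 < t → 0 < f t) ∧
    ∀ (B : Type w) [NonUnitalNormedRing B] [NormedSpace 𝕜 B] [IsScalarTower 𝕜 B B]
      [SMulCommClass 𝕜 B B] (φ : A →L[𝕜] B),
      (∀ a b : A, φ (a * b) = φ a * φ b) → Function.Injective φ →
        ∀ a : A, f ‖φ‖ * ‖a‖ ≤ ‖φ a‖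

end NormedAlgebras

/-! ### The spaces -/

section Spaces

variable (𝕜 : Type*) [RCLike 𝕜]

/-- The Banach space `c₀(Γ)`. -/
abbrev C0 (Γ : Type*) : Type _ := C0Sum 𝕜 (fun _ : Γ => 𝕜)

/-- The Banach space `ℓ₁(Γ)`. -/
abbrev L1 (Γ : Type*) : Type _ := L1Sum (fun _ : Γ => 𝕜)

/-- The direct sum of `(⨁ ℓ₂ⁿ)_{c₀}`, over `n = 1, 2, …`, and `c₀(Γ)`, with the maximum norm. -/
abbrev HilbertC0 (Γ : Type*) : Type _ :=
  C0Sum 𝕜 (fun n : ℕ => EuclideanSpace 𝕜 (Fin (n + 1))) × C0 𝕜 Γ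

/-- The direct sum of `(⨁ ℓ₂ⁿ)_{ℓ₁}`, over `n = 1, 2, …`, and `ℓ₁(Γ)`, with the sum norm. -/
abbrev HilbertL1 (Γ : Type*) : Type _ :=
  WithLp 1 (L1Sum (fun n : ℕ => EuclideanSpace 𝕜 (Fin (n + 1))) × L1 𝕜 Γ)

end Spaces

end CalkinIFP

end

universe w u v₁ v₂ v₃ v₄ v₅

/-!
Gliding hump. If `T` has essential norm greater than `K⁻¹`, there are vectors `xₙ` in the unit ball
and functionals `fₙ`, supported on disjoint finite sets of blocks of the codomain, such that the
matrix `fₘ (T xₙ)` is as close to the identity matrix as we like. Deleting finitely many blocks from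
the domain does not change the essential norm, so in the `c₀` case the `xₙ` can be taken disjointly
supported, and a functional on a `c₀`-sum is small off a finite set of blocks. In the `ℓ₁` case
almost norming vectors can be chosen so that their images almost agree on any given finite set of
blocks, by compactness, and are almost disjoint elsewhere; `xₙ` is half the difference of two of
them. With `U = (fₙ)` and `V eₙ = xₙ` the operator `U T V` is a small perturbation of the identity,
and multiplying `U` by its inverse makes it exactly the identity.

If `U T V` is the identity of `E`, then `V U T` is a non-compact idempotent. A non-zero idempotent
has norm at least `1` in every normed algebra, and this bounds a homomorphism `φ` from below.
-/

noncomputable section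

namespace CalkinIFP

section EssentialNorm

variable {𝕜 X Y : Type*} [RCLike 𝕜] [NormedAddCommGroup X] [NormedSpace 𝕜 X]
  [NormedAddCommGroup Y] [NormedSpace 𝕜 Y]

theorem essNorm_le_norm (T : X →L[𝕜] Y) : essNorm T ≤ ‖T‖ :=
  Submodule.Quotient.norm_mk_le _ T

theorem essNorm_sub_of_isCompactOperator (T : X →L[𝕜] Y) {S : X →L[𝕜] Y}
    (hS : IsCompactOperator S) : essNorm (T - S) = essNorm T := by
  have hmem : T - S - T ∈ compactOperator (RingHom.id 𝕜) X Y := by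
    rw [sub_sub_cancel_left]
    exact hS.neg
  rw [essNorm, (Submodule.Quotient.eq _).2 hmem, essNorm]

end EssentialNorm

section Decomposition

variable {𝕜 X Y ι κ : Type*} [RCLike 𝕜] [NormedAddCommGroup X] [NormedSpace 𝕜 X]
  [NormedAddCommGroup Y] [NormedSpace 𝕜 Y] {p : ι → X →L[𝕜] X} {q : κ → Y →L[𝕜] Y}

/-- The operator `∑ i ∈ A, p i`, the projection onto the blocks in `A` when the `p i` are mutually
orthogonal projections. -/
def partialProj (p : ι → X →L[𝕜] X) (A : Finset ι) : X →L[𝕜] X := ∑ i ∈ A, p i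

theorem partialProj_apply (A : Finset ι) (x : X) : partialProj p A x = ∑ i ∈ A, p i x := by
  simp [partialProj]

theorem isCompactOperator_partialProj (hp : ∀ i, IsCompactOperator (p i)) (A : Finset ι) :
    IsCompactOperator (partialProj p A) :=
  (compactOperator (RingHom.id 𝕜) X X).sum_mem (t := A) (f := fun i => (p i : X →L[𝕜] X))
    fun i _ => hp i

theorem apply_partialProj_of_mem (hp : OrthogonalIdempotents p) {A : Finset ι} {i : ι}
    (hi : i ∈ A) (x : X) : p i (partialProj p A x) = p i x :=
  DFunLike.congr_fun (hp.mul_sum_of_mem hi) x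

theorem apply_partialProj_of_notMem (hp : OrthogonalIdempotents p) {A : Finset ι} {i : ι}
    (hi : i ∉ A) (x : X) : p i (partialProj p A x) = 0 :=
  DFunLike.congr_fun (hp.mul_sum_of_notMem hi) x

theorem partialProj_partialProj [DecidableEq ι] (hp : OrthogonalIdempotents p) (A B : Finset ι)
    (x : X) : partialProj p A (partialProj p B x) = partialProj p (A ∩ B) x := by
  rw [partialProj_apply A, partialProj_apply (A ∩ B), ← Finset.filter_mem_eq_inter,
    Finset.sum_filter]
  refine Finset.sum_congr rfl fun i _ => ?_
  split_ifs with hi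
  · exact apply_partialProj_of_mem hp hi x
  · exact apply_partialProj_of_notMem hp hi x

/-- An unconditional Schauder decomposition of `X`, given by its coordinate projections, which are
moreover required to be compact. -/
structure IsCompactDecomposition (p : ι → X →L[𝕜] X) : Prop extends OrthogonalIdempotents p where
  isCompactOperator : ∀ i, IsCompactOperator (p i)
  hasSum : ∀ x, HasSum (fun i => p i x) x

namespace IsCompactDecomposition

theorem tendsto_partialProj (hp : IsCompactDecomposition p) (x : X) :
    Filter.Tendsto (fun A => partialProj p A x) Filter.atTop (nhds x) := by
  simp only [partialProj_apply]
  exact hp.hasSum x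

theorem exists_norm_partialProj_le_of_disjoint (hp : IsCompactDecomposition p) (x : X) {ε : ℝ}
    (hε : 0 < ε) : ∃ A : Finset ι, ∀ D, Disjoint A D → ‖partialProj p D x‖ ≤ ε := by
  obtain ⟨A, hA⟩ := (hp.hasSum x).summable.vanishing (Metric.closedBall_mem_nhds 0 hε)
  refine ⟨A, fun D hD => ?_⟩
  rw [partialProj_apply]
  exact mem_closedBall_zero_iff.1 (hA D hD.symm)

theorem exists_disjoint_lt_norm_map_partialProj (hp : IsCompactDecomposition p) (L : X →L[𝕜] Y)
    {A : Finset ι} {x : X} {r : ℝ} (h : r < ‖L (x - partialProj p A x)‖) :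
    ∃ D : Finset ι, Disjoint A D ∧ r < ‖L (partialProj p D x)‖ := by
  classical
  have hlim : Filter.Tendsto (fun B => ‖L (partialProj p B x - partialProj p A x)‖) Filter.atTop
      (nhds ‖L (x - partialProj p A x)‖) :=
    ((L.continuous.tendsto _).comp ((hp.tendsto_partialProj x).sub_const _)).norm
  obtain ⟨B, hB, hAB⟩ :=
    ((hlim.eventually (lt_mem_nhds h)).and (Filter.eventually_ge_atTop A)).exists
  refine ⟨B \ A, Finset.disjoint_sdiff, ?_⟩
  rwa [partialProj, ← Finset.sum_sdiff hAB, add_apply, ← partialProj, ← partialProj,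
    add_sub_cancel_right] at hB

end IsCompactDecomposition

end Decomposition

section GlidingHump

theorem exists_seq_of_forall_nat_finset_exists {α : Type*} (P : α → Prop) (r : ℕ → α → α → Prop)
    (hr : Antitone r)
    (h : ∀ (n : ℕ) (s : Finset α), (∀ x ∈ s, P x) → ∃ y, P y ∧ ∀ x ∈ s, r n x y) :
    ∃ f : ℕ → α, (∀ n, P (f n)) ∧ ∀ m n, m < n → r n (f m) (f n) := by
  classical
  -- The first component records how many points have been chosen.
  obtain ⟨f, hP, hf⟩ := exists_seq_of_forall_finset_exists (α := ℕ × α) (fun a => P a.2)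
    (fun a b => a.1 < b.1 ∧ r b.1 a.2 b.2) fun s hs => by
      obtain ⟨y, hy, hsy⟩ := h (s.sup Prod.fst + 1) (s.image Prod.snd)
        (by simpa only [Finset.forall_mem_image] using hs)
      exact ⟨(s.sup Prod.fst + 1, y), hy, fun a ha =>
        ⟨Nat.lt_succ_of_le (Finset.le_sup (f := Prod.fst) ha),
          hsy _ (Finset.mem_image_of_mem _ ha)⟩⟩
  have hlevel : StrictMono fun n => (f n).1 := fun m n hmn => (hf m n hmn).1
  exact ⟨fun n => (f n).2, hP, fun m n hmn => hr (hlevel.id_le n) _ _ (hf m n hmn).2⟩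

variable {𝕜 X Y κ : Type*} [RCLike 𝕜] [NormedAddCommGroup X] [NormedSpace 𝕜 X]
  [NormedAddCommGroup Y] [NormedSpace 𝕜 Y] {T : X →L[𝕜] Y} {q : κ → Y →L[𝕜] Y} {K : ℝ}

theorem exists_functional_eq_one_of_lt_norm (R : X →L[𝕜] Y) {x : X} (hK : 0 < K)
    (h : K⁻¹ < ‖R x‖) : ∃ f : X →L[𝕜] 𝕜, f x = 1 ∧ ∀ y, ‖f y‖ ≤ K * ‖R y‖ := by
  have hR : 0 < ‖R x‖ := (inv_pos.2 hK).trans h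
  obtain ⟨g, hg, hgx⟩ := exists_dual_vector'' 𝕜 (R x)
  have hinv : ‖(‖R x‖ : 𝕜)⁻¹‖ ≤ K := by
    rw [norm_inv, RCLike.norm_ofReal, abs_of_pos hR]
    exact inv_le_of_inv_le₀ hK h.le
  refine ⟨(‖R x‖ : 𝕜)⁻¹ • g ∘L R, ?_, fun y => ?_⟩
  · simp [hgx, hR.ne']
  · calc ‖(‖R x‖ : 𝕜)⁻¹ • g (R y)‖ = ‖(‖R x‖ : 𝕜)⁻¹‖ * ‖g (R y)‖ := norm_smul _ _
      _ ≤ K * ‖R y‖ := by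
        gcongr
        simpa using g.le_of_opNorm_le hg (R y)

/-- One step of the gliding hump argument for `T`: a vector of the unit ball whose image is
detected, with constant `K`, by a functional living on finitely many blocks of the
decomposition `q` of the codomain. -/
structure Hump (T : X →L[𝕜] Y) (q : κ → Y →L[𝕜] Y) (K : ℝ) where
  vec : X
  fnl : Y →L[𝕜] 𝕜
  blocks : Finset κ
  norm_vec_le : ‖vec‖ ≤ 1
  fnl_map_vec : fnl (T vec) = 1
  norm_fnl_le : ∀ y, ‖fnl y‖ ≤ K * ‖partialProj q blocks y‖

namespace Hump

theorem exists_vec_eq_of_lt_norm_tail (hq : IsCompactDecomposition q) (hK : 0 < K) {x : X}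
    (hx : ‖x‖ ≤ 1) {B : Finset κ} (h : K⁻¹ < ‖T x - partialProj q B (T x)‖) :
    ∃ b : Hump T q K, b.vec = x ∧ Disjoint B b.blocks := by
  obtain ⟨D, hBD, hD⟩ :=
    hq.exists_disjoint_lt_norm_map_partialProj (ContinuousLinearMap.id 𝕜 Y) h
  obtain ⟨f, hfx, hf⟩ := exists_functional_eq_one_of_lt_norm (partialProj q D) hK hD
  exact ⟨⟨x, f, D, hx, hfx, hf⟩, rfl, hBD⟩

theorem exists_finset_norm_map_vec_le (hq : IsCompactDecomposition q) (s : Finset (Hump T q K))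
    {δ : ℝ} (hδ : 0 < δ) : ∃ B : Finset κ, ∀ a ∈ s, a.blocks ⊆ B ∧
      ∀ D, Disjoint B D → ‖partialProj q D (T a.vec)‖ ≤ δ := by
  classical
  choose C hC using fun a : Hump T q K =>
    hq.exists_norm_partialProj_le_of_disjoint (T a.vec) hδ
  refine ⟨s.biUnion fun a => a.blocks ∪ C a, fun a ha => ?_⟩
  have hsub : a.blocks ∪ C a ⊆ s.biUnion fun a => a.blocks ∪ C a :=
    Finset.subset_biUnion_of_mem (fun a => a.blocks ∪ C a) ha
  exact ⟨Finset.union_subset_left hsub, fun D hD =>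
    hC a D (hD.mono_left (Finset.union_subset_right hsub))⟩

/-- `b` may follow `a` in a gliding hump sequence, up to the error `δ`. -/
structure Precedes (δ : ℝ) (a b : Hump T q K) : Prop where
  disjoint_blocks : Disjoint a.blocks b.blocks
  norm_fnl_left_le : ‖a.fnl (T b.vec)‖ ≤ δ
  norm_fnl_right_le : ‖b.fnl (T a.vec)‖ ≤ δ

theorem Precedes.mono {δ ε : ℝ} (hδε : δ ≤ ε) {a b : Hump T q K} (h : a.Precedes δ b) :
    a.Precedes ε b :=
  ⟨h.disjoint_blocks, h.norm_fnl_left_le.trans hδε, h.norm_fnl_right_le.trans hδε⟩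

theorem exists_precedes (hq : IsCompactDecomposition q) (hK : 0 < K) {P : X → Prop}
    {r : X → X → Prop} {s : Finset (Hump T q K)} {δ : ℝ} (hδ : 0 < δ)
    (step : ∀ B : Finset κ, (∀ a ∈ s, a.blocks ⊆ B) → ∃ x, ‖x‖ ≤ 1 ∧ P x ∧
      (∀ a ∈ s, r a.vec x ∧ ‖a.fnl (T x)‖ ≤ δ) ∧ K⁻¹ < ‖T x - partialProj q B (T x)‖) :
    ∃ b : Hump T q K, P b.vec ∧ ∀ a ∈ s, r a.vec b.vec ∧ a.Precedes δ b := by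
  obtain ⟨B, hB⟩ := exists_finset_norm_map_vec_le hq s (div_pos hδ hK)
  obtain ⟨x, hx, hPx, hsx, hTx⟩ := step B fun a ha => (hB a ha).1
  obtain ⟨b, rfl, hBb⟩ := exists_vec_eq_of_lt_norm_tail hq hK hx hTx
  refine ⟨b, hPx, fun a ha => ⟨(hsx a ha).1, ?_, (hsx a ha).2, ?_⟩⟩
  · exact hBb.mono_left (hB a ha).1
  · calc ‖b.fnl (T a.vec)‖ ≤ K * ‖partialProj q b.blocks (T a.vec)‖ := b.norm_fnl_le _
      _ ≤ K * (δ / K) := by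
        gcongr
        exact (hB a ha).2 _ hBb
      _ = δ := mul_div_cancel₀ δ hK.ne'

/-- A sequence of humps with disjoint blocks whose matrix `(fₘ (T xₙ))` is close to the identity. -/
structure IsGliding (η : ℝ) (h : ℕ → Hump T q K) : Prop where
  disjoint_blocks : Pairwise fun m n => Disjoint (h m).blocks (h n).blocks
  norm_fnl_le : ∀ m n, m ≠ n →
    ‖(h m).fnl (T (h n).vec)‖ ≤ η * (1 / 2) ^ (m + 1) * (1 / 2) ^ (n + 1)

theorem isGliding_of_precedes {η : ℝ} (hη : 0 ≤ η) {h : ℕ → Hump T q K}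
    (hh : ∀ m n, m < n → (h m).Precedes (η * (1 / 4) ^ (n + 1)) (h n)) : IsGliding η h := by
  have hpow : ∀ {m n : ℕ}, m < n →
      η * (1 / 4) ^ (n + 1) ≤ η * (1 / 2) ^ (m + 1) * (1 / 2) ^ (n + 1) := by
    intro m n hmn
    rw [mul_assoc, show (1 / 4 : ℝ) = 1 / 2 * (1 / 2) by norm_num, mul_pow]
    gcongr ?_ * (?_ * _)
    exact pow_le_pow_of_le_one (by norm_num) (by norm_num) (by lia)
  constructor
  · intro m n hmn
    rcases hmn.lt_or_gt with hlt | hlt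
    · exact (hh m n hlt).disjoint_blocks
    · exact (hh n m hlt).disjoint_blocks.symm
  · intro m n hmn
    rcases hmn.lt_or_gt with hlt | hlt
    · exact (hh m n hlt).norm_fnl_left_le.trans (hpow hlt)
    · rw [mul_right_comm]
      exact (hh n m hlt).norm_fnl_right_le.trans (hpow hlt)

theorem exists_isGliding (hq : IsCompactDecomposition q) (hK : 0 < K) {η : ℝ} (hη : 0 < η)
    (P : X → Prop) (r : X → X → Prop)
    (step : ∀ s : Finset (Hump T q K), (∀ a ∈ s, P a.vec) → ∀ δ : ℝ, 0 < δ →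
      ∀ B : Finset κ, (∀ a ∈ s, a.blocks ⊆ B) → ∃ x, ‖x‖ ≤ 1 ∧ P x ∧
        (∀ a ∈ s, r a.vec x ∧ ‖a.fnl (T x)‖ ≤ δ) ∧ K⁻¹ < ‖T x - partialProj q B (T x)‖) :
    ∃ h : ℕ → Hump T q K, IsGliding η h ∧ ∀ m n, m < n → r (h m).vec (h n).vec := by
  obtain ⟨h, -, hr⟩ := exists_seq_of_forall_nat_finset_exists (fun a : Hump T q K => P a.vec)
    (fun n a b => r a.vec b.vec ∧ a.Precedes (η * (1 / 4) ^ (n + 1)) b)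
    (fun m n hmn a b hab => ⟨hab.1, hab.2.mono <| mul_le_mul_of_nonneg_left
      (pow_le_pow_of_le_one (by norm_num) (by norm_num) (Nat.succ_le_succ hmn)) hη.le⟩)
    fun n s hs => exists_precedes hq hK (by positivity) (step s hs _ (by positivity))
  exact ⟨h, isGliding_of_precedes hη.le fun m n hmn => (hr m n hmn).2,
    fun m n hmn => (hr m n hmn).1⟩

end Hump

end GlidingHump

section Perturbation

variable {𝕜 E X Y : Type*} [RCLike 𝕜] [NormedAddCommGroup E] [NormedSpace 𝕜 E] [CompleteSpace E]
  [NormedAddCommGroup X] [NormedSpace 𝕜 X] [NormedAddCommGroup Y] [NormedSpace 𝕜 Y]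

theorem exists_left_inverse_of_norm_sub_le {R : E →L[𝕜] E} {η : ℝ} (hη0 : 0 ≤ η) (hη : η < 1)
    (h : ∀ x, ‖R x - x‖ ≤ η * ‖x‖) :
    ∃ S : E →L[𝕜] E, S ∘L R = ContinuousLinearMap.id 𝕜 E ∧ ‖S‖ ≤ (1 - η)⁻¹ := by
  have hnear : ‖1 - R‖ < 1 := by
    refine (ContinuousLinearMap.opNorm_le_bound _ hη0 fun x => ?_).trans_lt hη
    simpa [norm_sub_rev] using h x
  obtain ⟨u, rfl⟩ : IsUnit R := by simpa using isUnit_one_sub_of_norm_lt_one hnear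
  refine ⟨↑u⁻¹, u.inv_mul, ContinuousLinearMap.opNorm_le_bound _ (by simpa using hη.le)
    fun y => ?_⟩
  set x := (↑u⁻¹ : E →L[𝕜] E) y
  have hux : (u : E →L[𝕜] E) x = y := DFunLike.congr_fun u.mul_inv y
  have hxy : ‖y - x‖ ≤ η * ‖x‖ := hux ▸ h x
  rw [inv_mul_eq_div, le_div_iff₀ (by linarith)]
  linarith [norm_le_norm_add_norm_sub' x y, norm_sub_rev x y]

theorem exists_factorization_of_approx {T : X →L[𝕜] Y} {U : Y →L[𝕜] E} {V : E →L[𝕜] X}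
    {K : ℝ} (hK : 1 < K) (hU : ‖U‖ ≤ K) (hV : ‖V‖ ≤ 1)
    (h : ∀ x, ‖U (T (V x)) - x‖ ≤ (1 - K⁻¹) * ‖x‖) :
    ∃ (U : Y →L[𝕜] E) (V : E →L[𝕜] X),
      U ∘L T ∘L V = ContinuousLinearMap.id 𝕜 E ∧ ‖U‖ * ‖V‖ ≤ K * K := by
  have hK0 : 0 < K := by linarith
  obtain ⟨S, hS, hSK⟩ := exists_left_inverse_of_norm_sub_le (R := U ∘L T ∘L V)
    (by linarith [inv_lt_one_of_one_lt₀ hK]) (by linarith [inv_pos.2 hK0]) h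
  rw [sub_sub_cancel, inv_inv] at hSK
  refine ⟨S ∘L U, V, hS, ?_⟩
  calc ‖S ∘L U‖ * ‖V‖ ≤ (‖S‖ * ‖U‖) * ‖V‖ := by
        gcongr
        exact ContinuousLinearMap.opNorm_comp_le _ _
    _ ≤ (K * K) * 1 := by gcongr
    _ = K * K := mul_one _

theorem hasSum_mul_half_pow_succ (c : ℝ) :
    HasSum (fun n : ℕ => c * (1 / 2 : ℝ) ^ (n + 1)) c := by
  convert! hasSum_geometric_two' c using 2 with n
  rw [pow_succ, one_div_pow]
  ring

/-- Coordinate functionals on `E` for which the norm of `E` lies between the supremum norm and the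
`ℓ₁`-norm of the coordinates, as it does in both `c₀` and `ℓ₁`. -/
structure IsBetweenSupAndL1 (e : ℕ → E →L[𝕜] 𝕜) : Prop where
  norm_apply_le : ∀ n x, ‖e n x‖ ≤ ‖x‖
  norm_le_of_hasSum : ∀ {x : E} {b : ℕ → ℝ} {s : ℝ}, (∀ n, ‖e n x‖ ≤ b n) → HasSum b s → ‖x‖ ≤ s

namespace Hump.IsGliding

variable {κ : Type*} {T : X →L[𝕜] Y} {q : κ → Y →L[𝕜] Y} {K η : ℝ} {h : ℕ → Hump T q K}

theorem norm_fnl_map_sub_le (hh : IsGliding η h) (hη : 0 ≤ η) {c : ℕ → 𝕜} {x : X} {M : ℝ}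
    (hx : HasSum (fun n => c n • (h n).vec) x) (hM : ∀ n, ‖c n‖ ≤ M) (m : ℕ) :
    ‖(h m).fnl (T x) - c m‖ ≤ η * M * (1 / 2) ^ (m + 1) := by
  have hM0 : 0 ≤ M := (norm_nonneg _).trans (hM 0)
  have hmap : HasSum (fun n => c n * (h m).fnl (T (h n).vec)) ((h m).fnl (T x)) := by
    simpa using ((h m).fnl ∘L T).hasSum hx
  refine (hmap.sub (hasSum_ite_eq m (c m))).norm_le_of_bounded (hasSum_mul_half_pow_succ _)
    fun n => ?_
  split_ifs with hnm
  · subst hnm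
    rw [(h n).fnl_map_vec, mul_one, sub_self, norm_zero]
    positivity
  · rw [sub_zero, norm_mul]
    calc ‖c n‖ * ‖(h m).fnl (T (h n).vec)‖
        ≤ M * (η * (1 / 2) ^ (m + 1) * (1 / 2) ^ (n + 1)) := by
          gcongr
          · exact hM n
          · exact hh.norm_fnl_le m n (Ne.symm hnm)
      _ = η * M * (1 / 2) ^ (m + 1) * (1 / 2) ^ (n + 1) := by ring

theorem exists_factorization {e : ℕ → E →L[𝕜] 𝕜} (he : IsBetweenSupAndL1 e) (hK : 1 < K)
    (hh : IsGliding (1 - K⁻¹) h) {U : Y →L[𝕜] E} (hU : ‖U‖ ≤ K)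
    (heU : ∀ n y, e n (U y) = (h n).fnl y) {V : E →L[𝕜] X} (hV : ‖V‖ ≤ 1)
    (hVa : ∀ a, HasSum (fun n => e n a • (h n).vec) (V a)) :
    ∃ (U : Y →L[𝕜] E) (V : E →L[𝕜] X),
      U ∘L T ∘L V = ContinuousLinearMap.id 𝕜 E ∧ ‖U‖ * ‖V‖ ≤ K * K := by
  refine exists_factorization_of_approx (T := T) hK hU hV fun a =>
    he.norm_le_of_hasSum (fun m => ?_) (hasSum_mul_half_pow_succ _)
  rw [map_sub, heU]
  exact hh.norm_fnl_map_sub_le (sub_nonneg.2 (inv_lt_one_of_one_lt₀ hK).le) (hVa a)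
    (fun n => he.norm_apply_le n a) m

end Hump.IsGliding

end Perturbation

section SequenceSpaces

theorem L1Sum.hasSum_norm {ι : Type*} {F : ι → Type*} [∀ i, NormedAddCommGroup (F i)]
    (x : L1Sum F) : HasSum (fun i => ‖x i‖) ‖x‖ := by
  simpa using lp.hasSum_norm (by simp) x

variable {𝕜 X : Type*} [RCLike 𝕜] [NormedAddCommGroup X] [NormedSpace 𝕜 X]
  {ι : Type*} {F : ι → Type*} [∀ i, NormedAddCommGroup (F i)] [∀ i, NormedSpace 𝕜 (F i)]

variable (𝕜 F) in
/-- The `i`-th coordinate map of a `c₀`-direct sum; its counterpart for `ℓ₁`-direct sums is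
`lp.evalCLM`. -/
def C0Sum.evalCLM (i : ι) : C0Sum 𝕜 F →L[𝕜] F i :=
  lp.evalCLM 𝕜 F ∞ i ∘L (c0Submodule 𝕜 F).subtypeL

theorem C0Sum.norm_le_iff {x : C0Sum 𝕜 F} {r : ℝ} (hr : 0 ≤ r) :
    ‖x‖ ≤ r ↔ ∀ i, ‖evalCLM 𝕜 F i x‖ ≤ r :=
  ⟨fun h i => (lp.norm_apply_le_norm ENNReal.top_ne_zero x.1 i).trans h, lp.norm_le_of_forall_le hr⟩

theorem C0Sum.norm_evalCLM_le (i : ι) (x : C0Sum 𝕜 F) : ‖evalCLM 𝕜 F i x‖ ≤ ‖x‖ :=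
  (norm_le_iff (norm_nonneg x)).1 le_rfl i

theorem C0.isBetweenSupAndL1 : IsBetweenSupAndL1 (C0Sum.evalCLM 𝕜 (fun _ : ℕ => 𝕜)) where
  norm_apply_le := C0Sum.norm_evalCLM_le
  norm_le_of_hasSum hb hs :=
    have hb0 := fun n => (norm_nonneg _).trans (hb n)
    (C0Sum.norm_le_iff (hs.nonneg hb0)).2 fun n =>
      (hb n).trans (le_hasSum hs n fun m _ => hb0 m)

theorem L1.isBetweenSupAndL1 : IsBetweenSupAndL1 (lp.evalCLM 𝕜 (fun _ : ℕ => 𝕜) 1) where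
  norm_apply_le n x := lp.norm_apply_le_norm one_ne_zero x n
  norm_le_of_hasSum hb hs := hasSum_le hb (L1Sum.hasSum_norm _) hs

theorem C0.exists_clm_apply_eq {g : ℕ → X →L[𝕜] 𝕜} {K : ℝ} (hK : 0 ≤ K)
    (hg : ∀ n x, ‖g n x‖ ≤ K * ‖x‖) (hfin : ∀ x, ∀ ε : ℝ, 0 < ε → {n | ε ≤ ‖g n x‖}.Finite) :
    ∃ U : X →L[𝕜] C0 𝕜 ℕ, ‖U‖ ≤ K ∧ ∀ n x, C0Sum.evalCLM 𝕜 _ n (U x) = g n x := by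
  let U : X →ₗ[𝕜] C0 𝕜 ℕ :=
    { toFun x := ⟨⟨fun n => g n x, memℓp_infty ⟨K * ‖x‖, Set.forall_mem_range.2 (hg · x)⟩⟩, hfin x⟩
      map_add' x y := Subtype.ext (lp.ext (funext fun n => map_add (g n) x y))
      map_smul' c x := Subtype.ext (lp.ext (funext fun n => map_smul (g n) c x)) }
  exact ⟨U.mkContinuous K fun x => (C0Sum.norm_le_iff (by positivity)).2 (hg · x),
    U.mkContinuous_norm_le hK _, fun _ _ => rfl⟩

theorem L1.exists_clm_apply_eq {g : ℕ → X →L[𝕜] 𝕜} {K : ℝ} (hK : 0 ≤ K)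
    (hg : ∀ (s : Finset ℕ) x, ∑ n ∈ s, ‖g n x‖ ≤ K * ‖x‖) :
    ∃ U : X →L[𝕜] L1 𝕜 ℕ, ‖U‖ ≤ K ∧ ∀ n x, lp.evalCLM 𝕜 _ 1 n (U x) = g n x := by
  have hsum : ∀ x, Summable fun n => ‖g n x‖ := fun x =>
    summable_of_sum_le (fun _ => norm_nonneg _) (hg · x)
  let U : X →ₗ[𝕜] L1 𝕜 ℕ :=
    { toFun x := ⟨fun n => g n x, memℓp_gen (by simpa using hsum x)⟩
      map_add' x y := lp.ext (funext fun n => map_add (g n) x y)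
      map_smul' c x := lp.ext (funext fun n => map_smul (g n) c x) }
  refine ⟨U.mkContinuous K fun x => ?_, U.mkContinuous_norm_le hK _, fun _ _ => rfl⟩
  rw [(L1Sum.hasSum_norm (U x)).tsum_eq.symm]
  exact (hsum x).tsum_le_of_sum_le (hg · x)

theorem exists_clm_hasSum_smul {E : Type*} [NormedAddCommGroup E] [NormedSpace 𝕜 E]
    (e : ℕ → E →L[𝕜] 𝕜) (v : ℕ → X) (hs : ∀ a, Summable fun n => e n a • v n)
    (hb : ∀ a, ∀ s : Finset ℕ, ‖∑ n ∈ s, e n a • v n‖ ≤ ‖a‖) :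
    ∃ V : E →L[𝕜] X, ‖V‖ ≤ 1 ∧ ∀ a, HasSum (fun n => e n a • v n) (V a) := by
  let V : E →ₗ[𝕜] X :=
    { toFun a := ∑' n, e n a • v n
      map_add' a b := by simp only [map_add, add_smul, (hs a).tsum_add (hs b)]
      map_smul' c a := by
        simp only [map_smul, smul_assoc, (hs a).tsum_const_smul, RingHom.id_apply] }
  refine ⟨V.mkContinuous 1 fun a => ?_, V.mkContinuous_norm_le zero_le_one _,
    fun a => (hs a).hasSum⟩
  rw [one_mul]
  exact le_of_tendsto (hs a).hasSum.norm (Filter.Eventually.of_forall (hb a))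

theorem C0.exists_clm_hasSum_smul [CompleteSpace X] {v : ℕ → X}
    (hv : ∀ (c : ℕ → 𝕜) (s : Finset ℕ) (M : ℝ), 0 ≤ M → (∀ n ∈ s, ‖c n‖ ≤ M) →
      ‖∑ n ∈ s, c n • v n‖ ≤ M) :
    ∃ V : C0 𝕜 ℕ →L[𝕜] X, ‖V‖ ≤ 1 ∧
      ∀ a, HasSum (fun n => C0Sum.evalCLM 𝕜 _ n a • v n) (V a) := by
  refine CalkinIFP.exists_clm_hasSum_smul _ v (fun a => ?_) fun a s =>
    hv _ s _ (norm_nonneg _) fun n _ => C0Sum.norm_evalCLM_le n a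
  refine summable_iff_vanishing_norm.2 fun ε hε => ?_
  have hfin := a.2 (ε / 2) (half_pos hε)
  refine ⟨hfin.toFinset, fun t ht =>
    (hv _ t (ε / 2) (half_pos hε).le fun n hn => ?_).trans_lt (half_lt_self hε)⟩
  have hn' : n ∉ hfin.toFinset := Finset.disjoint_left.1 ht hn
  exact (not_le.1 fun h => hn' (hfin.mem_toFinset.2 h)).le

theorem L1.exists_clm_hasSum_smul [CompleteSpace X] {v : ℕ → X} (hv : ∀ n, ‖v n‖ ≤ 1) :
    ∃ V : L1 𝕜 ℕ →L[𝕜] X, ‖V‖ ≤ 1 ∧ ∀ a, HasSum (fun n => lp.evalCLM 𝕜 _ 1 n a • v n) (V a) := by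
  have hle : ∀ (a : L1 𝕜 ℕ) n, ‖lp.evalCLM 𝕜 _ 1 n a • v n‖ ≤ ‖a n‖ := fun a n => by
    rw [norm_smul]
    exact mul_le_of_le_one_right (norm_nonneg _) (hv n)
  refine CalkinIFP.exists_clm_hasSum_smul _ v (fun a =>
    (L1Sum.hasSum_norm a).summable.of_norm_bounded (hle a)) fun a s => ?_
  exact (norm_sum_le_of_le _ fun n _ => hle a n).trans
    (sum_le_hasSum s (fun _ _ => norm_nonneg _) (L1Sum.hasSum_norm a))

end SequenceSpaces

section C0Decomposition

variable {𝕜 X Y ι κ : Type*} [RCLike 𝕜] [NormedAddCommGroup X] [NormedSpace 𝕜 X]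
  [NormedAddCommGroup Y] [NormedSpace 𝕜 Y] {p : ι → X →L[𝕜] X} {q : κ → Y →L[𝕜] Y}

theorem IsCompactDecomposition.exists_disjoint_lt_norm_map_sub (hp : IsCompactDecomposition p)
    {T S : X →L[𝕜] Y} (hS : IsCompactOperator S) {r : ℝ} (hr : r < essNorm T) (A : Finset ι) :
    ∃ D : Finset ι, Disjoint A D ∧
      ∃ x, ‖x‖ ≤ 1 ∧ r < ‖T (partialProj p D x) - S (partialProj p D x)‖ := by
  have hcompact : IsCompactOperator ((T - S) ∘L partialProj p A) :=
    (isCompactOperator_partialProj hp.isCompactOperator A).clm_comp (T - S)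
  rw [← essNorm_sub_of_isCompactOperator T hS, ← essNorm_sub_of_isCompactOperator _ hcompact] at hr
  obtain ⟨x, hx, hrx⟩ :=
    ContinuousLinearMap.exists_lt_apply_of_lt_opNorm _ (hr.trans_le (essNorm_le_norm _))
  rw [sub_apply, ContinuousLinearMap.comp_apply, ← map_sub] at hrx
  obtain ⟨D, hAD, hD⟩ := hp.exists_disjoint_lt_norm_map_partialProj (T - S) hrx
  exact ⟨D, hAD, x, hx.le, hD⟩

/-- The set of blocks on which `x` does not vanish. -/
def blockSupport (p : ι → X →L[𝕜] X) (x : X) : Set ι := {i | p i x ≠ 0}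

theorem blockSupport_partialProj_subset (hp : OrthogonalIdempotents p) (A : Finset ι) (x : X) :
    blockSupport p (partialProj p A x) ⊆ A :=
  fun _ hi => not_not.1 fun h => hi (apply_partialProj_of_notMem hp h x)

theorem blockSupport_smul_subset (c : 𝕜) (x : X) : blockSupport p (c • x) ⊆ blockSupport p x :=
  fun i hi h => hi (by rw [map_smul, h, smul_zero])

/-- A compact decomposition for which the norm of a vector is the supremum of the norms of its
components. -/
structure IsC0Decomposition (p : ι → X →L[𝕜] X) : Prop extends IsCompactDecomposition p where
  norm_le_iff : ∀ x r, 0 ≤ r → (‖x‖ ≤ r ↔ ∀ i, ‖p i x‖ ≤ r)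

namespace IsC0Decomposition

theorem norm_apply_le (hp : IsC0Decomposition p) (i : ι) (x : X) : ‖p i x‖ ≤ ‖x‖ :=
  (hp.norm_le_iff x _ (norm_nonneg x)).1 le_rfl i

theorem norm_partialProj_le (hp : IsC0Decomposition p) (A : Finset ι) (x : X) :
    ‖partialProj p A x‖ ≤ ‖x‖ := by
  refine (hp.norm_le_iff _ _ (norm_nonneg x)).2 fun i => ?_
  by_cases hi : i ∈ A
  · rw [apply_partialProj_of_mem hp.toOrthogonalIdempotents hi]
    exact hp.norm_apply_le i x
  · rw [apply_partialProj_of_notMem hp.toOrthogonalIdempotents hi, norm_zero]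
    exact norm_nonneg x

theorem norm_sum_le_of_pairwiseDisjoint (hp : IsC0Decomposition p) {α : Type*} {s : Finset α}
    {v : α → X} {M : ℝ} (hd : (s : Set α).PairwiseDisjoint fun n => blockSupport p (v n))
    (hM : 0 ≤ M) (hv : ∀ n ∈ s, ‖v n‖ ≤ M) : ‖∑ n ∈ s, v n‖ ≤ M := by
  refine (hp.norm_le_iff _ _ hM).2 fun i => ?_
  rw [map_sum]
  by_cases hi : ∃ n ∈ s, i ∈ blockSupport p (v n)
  · obtain ⟨n, hn, hin⟩ := hi
    rw [Finset.sum_eq_single_of_mem n hn fun m hm hmn =>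
      not_not.1 fun him => Set.disjoint_left.1 (hd hm hn hmn) him hin]
    exact (hp.norm_apply_le i _).trans (hv n hn)
  · rw [Finset.sum_eq_zero fun n hn => not_not.1 fun hin => hi ⟨n, hn, hin⟩, norm_zero]
    exact hM

theorem norm_add_le_of_disjoint (hp : IsC0Decomposition p) {x y : X} {M : ℝ}
    (hd : Disjoint (blockSupport p x) (blockSupport p y)) (hx : ‖x‖ ≤ M) (hy : ‖y‖ ≤ M) :
    ‖x + y‖ ≤ M := by
  have h := hp.norm_sum_le_of_pairwiseDisjoint (s := Finset.univ) (v := ![x, y]) (M := M)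
  simp_all [Set.PairwiseDisjoint, Set.Pairwise, Fin.forall_fin_two, Function.onFun, hd.symm,
    (norm_nonneg x).trans hx]

theorem norm_map_add_norm_map_le (hp : IsC0Decomposition p) (f : X →L[𝕜] 𝕜) {x y : X}
    (hd : Disjoint (blockSupport p x) (blockSupport p y)) (hx : ‖x‖ ≤ 1) (hy : ‖y‖ ≤ 1) :
    ‖f x‖ + ‖f y‖ ≤ ‖f‖ := by
  obtain ⟨c, hc, hcx⟩ := RCLike.exists_norm_eq_mul_self (f x)
  obtain ⟨d, hd1, hdy⟩ := RCLike.exists_norm_eq_mul_self (f y)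
  have hball : ‖c • x + d • y‖ ≤ 1 :=
    hp.norm_add_le_of_disjoint
      (hd.mono (blockSupport_smul_subset c x) (blockSupport_smul_subset d y))
      (by rwa [norm_smul, hc, one_mul]) (by rwa [norm_smul, hd1, one_mul])
  have hval : f (c • x + d • y) = ((‖f x‖ + ‖f y‖ : ℝ) : 𝕜) := by
    rw [map_add, map_smul, map_smul, smul_eq_mul, smul_eq_mul, ← hcx, ← hdy, RCLike.ofReal_add]
  calc ‖f x‖ + ‖f y‖ = ‖f (c • x + d • y)‖ := by
        rw [hval, RCLike.norm_ofReal, abs_of_nonneg (by positivity)]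
    _ ≤ ‖f‖ := f.unit_le_opNorm _ hball

theorem exists_norm_map_le_of_disjoint (hp : IsC0Decomposition p) (f : X →L[𝕜] 𝕜) {δ : ℝ}
    (hδ : 0 < δ) : ∃ A : Finset ι, ∀ x, Disjoint ↑A (blockSupport p x) → ‖x‖ ≤ 1 → ‖f x‖ ≤ δ := by
  obtain ⟨z, hz, hfz⟩ := f.exists_lt_apply_of_lt_opNorm (sub_lt_self ‖f‖ hδ)
  obtain ⟨A, hA⟩ : ∃ A, ‖f‖ - δ < ‖f (partialProj p A z)‖ :=
    (((f.continuous.tendsto z).comp (hp.tendsto_partialProj z)).norm.eventually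
      (lt_mem_nhds hfz)).exists
  refine ⟨A, fun x hx hx1 => ?_⟩
  have hsum := hp.norm_map_add_norm_map_le f
    (hx.mono_left (blockSupport_partialProj_subset hp.toOrthogonalIdempotents A z))
    ((hp.norm_partialProj_le A z).trans hz.le) hx1
  linarith

theorem exists_finset_blockSupport_subset (hp : IsC0Decomposition p) {T : X →L[𝕜] Y} {K δ : ℝ}
    (s : Finset (Hump T q K)) (hs : ∀ a ∈ s, (blockSupport p a.vec).Finite) (hδ : 0 < δ) :
    ∃ A : Finset ι, ∀ a ∈ s, blockSupport p a.vec ⊆ A ∧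
      ∀ x, Disjoint ↑A (blockSupport p x) → ‖x‖ ≤ 1 → ‖a.fnl (T x)‖ ≤ δ := by
  classical
  choose A hA using fun a : Hump T q K => hp.exists_norm_map_le_of_disjoint (a.fnl ∘L T) hδ
  have hfin : (⋃ a ∈ s, blockSupport p a.vec ∪ A a).Finite :=
    s.finite_toSet.biUnion fun a ha => (hs a ha).union (A a).finite_toSet
  refine ⟨hfin.toFinset, fun a ha => ?_⟩
  have hsub : blockSupport p a.vec ∪ A a ⊆ hfin.toFinset := by
    rw [hfin.coe_toFinset]
    exact Set.subset_biUnion_of_mem (u := fun a => blockSupport p a.vec ∪ A a) ha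
  exact ⟨Set.subset_union_left.trans hsub, fun x hx =>
    hA a x (hx.mono_left (Set.subset_union_right.trans hsub))⟩

theorem exists_isGliding (hp : IsC0Decomposition p) (hq : IsCompactDecomposition q)
    {T : X →L[𝕜] Y} {K η : ℝ} (hK : 0 < K) (hT : K⁻¹ < essNorm T) (hη : 0 < η) :
    ∃ h : ℕ → Hump T q K, Hump.IsGliding η h ∧
      Pairwise fun m n => Disjoint (blockSupport p (h m).vec) (blockSupport p (h n).vec) := by
  obtain ⟨h, hh, hd⟩ := Hump.exists_isGliding hq hK hη
    (fun x => (blockSupport p x).Finite)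
    (fun x y => Disjoint (blockSupport p x) (blockSupport p y)) (T := T)
    fun s hs δ hδ B _ => by
      obtain ⟨A, hA⟩ := hp.exists_finset_blockSupport_subset s hs hδ
      obtain ⟨D, hAD, x, hx, hDx⟩ := hp.exists_disjoint_lt_norm_map_sub
        (S := partialProj q B ∘L T)
        ((isCompactOperator_partialProj hq.isCompactOperator B).comp_clm T) hT A
      have hsupp := blockSupport_partialProj_subset hp.toOrthogonalIdempotents D x
      have hdisj : Disjoint ↑A (blockSupport p (partialProj p D x)) :=
        (Finset.disjoint_coe.2 hAD).mono_right hsupp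
      have hnorm := (hp.norm_partialProj_le D x).trans hx
      exact ⟨partialProj p D x, hnorm, D.finite_toSet.subset hsupp,
        fun a ha => ⟨hdisj.mono_left (hA a ha).1, (hA a ha).2 _ hdisj hnorm⟩, hDx⟩
  exact ⟨h, hh, fun m n hmn => hmn.lt_or_gt.elim (hd m n) fun hnm => (hd n m hnm).symm⟩

end IsC0Decomposition

namespace Hump

variable {T : X →L[𝕜] Y} {K : ℝ}

theorem finite_setOf_le_norm_fnl (hq : IsCompactDecomposition q) (hK : 0 < K)
    {h : ℕ → Hump T q K} (hd : Pairwise fun m n => Disjoint (h m).blocks (h n).blocks) (y : Y)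
    {ε : ℝ} (hε : 0 < ε) : {n | ε ≤ ‖(h n).fnl y‖}.Finite := by
  obtain ⟨A, hA⟩ := hq.exists_norm_partialProj_le_of_disjoint y (ε := ε / K / 2) (by positivity)
  have hfin : (⋃ i ∈ A, {n | i ∈ (h n).blocks}).Finite :=
    A.finite_toSet.biUnion fun i _ => Set.Subsingleton.finite fun m hm n hn =>
      by_contra fun hmn => Finset.disjoint_left.1 (hd hmn) hm hn
  refine hfin.subset fun n hn => ?_
  simp only [Set.mem_iUnion₂, exists_prop]
  refine Finset.not_disjoint_iff.1 fun hdisj => ?_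
  have hle : ε ≤ K * (ε / K / 2) := hn.trans <| ((h n).norm_fnl_le y).trans <| by
    gcongr
    exact hA _ hdisj
  rw [← mul_div_assoc, mul_div_cancel₀ ε hK.ne'] at hle
  linarith

end Hump

theorem IdentityFactors.of_exists_factorization {E : Type*} [NormedAddCommGroup E]
    [NormedSpace 𝕜 E]
    (h : ∀ (T : X →L[𝕜] Y) (K : ℝ), 1 < K → K⁻¹ < essNorm T → ∃ (U : Y →L[𝕜] E) (V : E →L[𝕜] X),
      U ∘L T ∘L V = ContinuousLinearMap.id 𝕜 E ∧ ‖U‖ * ‖V‖ ≤ K * K) :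
    IdentityFactors 𝕜 E X Y := by
  intro T _ hT C hC
  have hK : 1 < √C := Real.lt_sqrt_of_sq_lt (by simpa using hC)
  rw [← Real.mul_self_sqrt (by linarith : 0 ≤ C)]
  exact h T (√C) hK (by simpa only [hT] using inv_lt_one_of_one_lt₀ hK)

theorem IsC0Decomposition.identityFactors [CompleteSpace X] (hp : IsC0Decomposition p)
    (hq : IsC0Decomposition q) : IdentityFactors 𝕜 (C0 𝕜 ℕ) X Y := by
  refine .of_exists_factorization fun T K hK hT => ?_
  have hK0 : 0 < K := by linarith
  obtain ⟨h, hh, hd⟩ := hp.exists_isGliding hq.toIsCompactDecomposition hK0 hT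
    (sub_pos.2 (inv_lt_one_of_one_lt₀ hK))
  obtain ⟨U, hU, heU⟩ := C0.exists_clm_apply_eq hK0.le
    (fun n y => ((h n).norm_fnl_le y).trans
      (mul_le_mul_of_nonneg_left (hq.norm_partialProj_le _ y) hK0.le))
    fun y _ hε => Hump.finite_setOf_le_norm_fnl hq.toIsCompactDecomposition hK0
      hh.disjoint_blocks y hε
  obtain ⟨V, hV, hVa⟩ := C0.exists_clm_hasSum_smul (𝕜 := 𝕜) (v := fun n => (h n).vec)
    fun c s M hM hc => hp.norm_sum_le_of_pairwiseDisjoint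
      (fun m _ n _ hmn => (hd hmn).mono (blockSupport_smul_subset _ _)
        (blockSupport_smul_subset _ _)) hM
      fun n hn => by
        rw [norm_smul]
        exact (mul_le_of_le_one_right (norm_nonneg _) (h n).norm_vec_le).trans (hc n hn)
  exact hh.exists_factorization C0.isBetweenSupAndL1 hK hU heU hV hVa

end C0Decomposition

section L1Decomposition

variable {𝕜 X Y κ : Type*} [RCLike 𝕜] [NormedAddCommGroup X] [NormedSpace 𝕜 X]
  [NormedAddCommGroup Y] [NormedSpace 𝕜 Y] {q : κ → Y →L[𝕜] Y}

theorem sub_partialProj_sub_partialProj_of_subset (hq : OrthogonalIdempotents q) {A C : Finset κ}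
    (h : A ⊆ C) (y : Y) :
    y - partialProj q A y - partialProj q C (y - partialProj q A y) = y - partialProj q C y := by
  classical
  rw [map_sub, partialProj_partialProj hq, Finset.inter_eq_right.2 h]
  abel

/-- A compact decomposition for which the norm of a vector is the sum of the norms of its
components. -/
structure IsL1Decomposition (q : κ → Y →L[𝕜] Y) : Prop extends IsCompactDecomposition q where
  hasSum_norm : ∀ y, HasSum (fun i => ‖q i y‖) ‖y‖

namespace IsL1Decomposition

theorem norm_partialProj (hq : IsL1Decomposition q) (A : Finset κ) (y : Y) :
    ‖partialProj q A y‖ = ∑ i ∈ A, ‖q i y‖ := by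
  refine (hq.hasSum_norm _).unique ?_
  rw [Finset.sum_congr rfl fun i hi => by
    rw [← apply_partialProj_of_mem hq.toOrthogonalIdempotents hi y]]
  exact hasSum_sum_of_ne_finset_zero fun i hi => by
    rw [apply_partialProj_of_notMem hq.toOrthogonalIdempotents hi, norm_zero]

theorem norm_sub_partialProj (hq : IsL1Decomposition q) (A : Finset κ) (y : Y) :
    ‖y - partialProj q A y‖ = ‖y‖ - ‖partialProj q A y‖ := by
  refine (hq.hasSum_norm _).unique ?_
  refine ((hq.hasSum_norm y).sub (hq.hasSum_norm (partialProj q A y))).congr_fun fun i => ?_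
  rw [map_sub]
  by_cases hi : i ∈ A
  · simp only [apply_partialProj_of_mem hq.toOrthogonalIdempotents hi, sub_self, norm_zero]
  · simp only [apply_partialProj_of_notMem hq.toOrthogonalIdempotents hi, sub_zero, norm_zero]

theorem norm_partialProj_mono (hq : IsL1Decomposition q) {A C : Finset κ} (h : A ⊆ C) (y : Y) :
    ‖partialProj q A y‖ ≤ ‖partialProj q C y‖ := by
  rw [hq.norm_partialProj, hq.norm_partialProj]
  exact Finset.sum_le_sum_of_subset_of_nonneg h fun _ _ _ => norm_nonneg _

theorem norm_sub_partialProj_anti (hq : IsL1Decomposition q) {A C : Finset κ} (h : A ⊆ C) (y : Y) :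
    ‖y - partialProj q C y‖ ≤ ‖y - partialProj q A y‖ := by
  rw [hq.norm_sub_partialProj, hq.norm_sub_partialProj]
  exact sub_le_sub_left (hq.norm_partialProj_mono h y) _

theorem sum_norm_partialProj_le (hq : IsL1Decomposition q) {α : Type*} (s : Finset α)
    {D : α → Finset κ} (hD : (s : Set α).PairwiseDisjoint D) (y : Y) :
    ∑ n ∈ s, ‖partialProj q (D n) y‖ ≤ ‖y‖ := by
  classical
  simp only [hq.norm_partialProj]
  rw [← Finset.sum_biUnion hD]
  exact sum_le_hasSum _ (fun _ _ => norm_nonneg _) (hq.hasSum_norm y)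

theorem norm_add_norm_le_norm_sub_add (hq : IsL1Decomposition q) (A : Finset κ) (x y : Y) :
    ‖x‖ + ‖y‖ ≤ ‖x - y‖ + 2 * (‖x - partialProj q A x‖ + ‖partialProj q A y‖) := by
  have hin := norm_sub_norm_le (partialProj q A x) (partialProj q A y)
  have hout := (norm_sub_norm_le (y - partialProj q A y) (x - partialProj q A x)).trans_eq
    (norm_sub_rev _ _)
  have hxy := hq.norm_sub_partialProj A (x - y)
  rw [map_sub] at hxy
  rw [sub_sub_sub_comm] at hout
  linarith [hq.norm_sub_partialProj A x, hq.norm_sub_partialProj A y]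

theorem exists_superset_forall_exists_lt_norm (hq : IsL1Decomposition q) (T : X →L[𝕜] Y)
    (B : Finset κ) {δ : ℝ} (hδ : 0 < δ) :
    ∃ A, B ⊆ A ∧ ∀ C, ∃ x, ‖x‖ ≤ 1 ∧
      ‖T - partialProj q A ∘L T‖ - δ < ‖T x - partialProj q C (T x)‖ := by
  classical
  obtain ⟨A, hA⟩ := exists_lt_of_ciInf_lt (f := fun A => ‖T - partialProj q A ∘L T‖)
    (lt_add_of_pos_right _ hδ)
  have hanti : ‖T - partialProj q (A ∪ B) ∘L T‖ ≤ ‖T - partialProj q A ∘L T‖ :=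
    ContinuousLinearMap.opNorm_le_bound _ (norm_nonneg _) fun x =>
      (hq.norm_sub_partialProj_anti Finset.subset_union_left (T x)).trans
        ((T - partialProj q A ∘L T).le_opNorm x)
  refine ⟨A ∪ B, Finset.subset_union_right, fun C => ?_⟩
  have hinf : ⨅ A, ‖T - partialProj q A ∘L T‖ ≤ ‖T - partialProj q C ∘L T‖ :=
    ciInf_le ⟨0, Set.forall_mem_range.2 fun _ => norm_nonneg _⟩ C
  obtain ⟨x, hx, hTx⟩ := (T - partialProj q C ∘L T).exists_lt_apply_of_lt_opNorm
    (r := ‖T - partialProj q (A ∪ B) ∘L T‖ - δ) (by linarith)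
  exact ⟨x, hx.le, hTx⟩

end IsL1Decomposition

theorem frequently_frequently_norm_map_sub_lt {S : X →L[𝕜] Y} (hS : IsCompactOperator S) {α : Type*}
    {l : Filter α} [l.NeBot] {x : α → X} (hx : ∀ a, ‖x a‖ ≤ 1) {δ : ℝ} (hδ : 0 < δ) :
    ∃ᶠ a in l, ∃ᶠ b in l, ‖S (x a) - S (x b)‖ < δ := by
  obtain ⟨w, -, hw⟩ := (hS.isCompact_closure_image_closedBall 1).exists_mapClusterPt_of_frequently
    (l := l) (f := fun a => S (x a)) <| Filter.Frequently.of_forall fun a =>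
      subset_closure (Set.mem_image_of_mem S (mem_closedBall_zero_iff.2 (hx a)))
  have hnear : ∃ᶠ a in l, dist (S (x a)) w < δ / 2 :=
    hw.frequently (Metric.ball_mem_nhds w (half_pos hδ))
  refine hnear.mono fun a ha => hnear.mono fun b hb => ?_
  rw [← dist_eq_norm]
  exact (dist_triangle_right _ _ w).trans_lt (by linarith)

namespace IsL1Decomposition

theorem exists_superset_exists_pair (hq : IsL1Decomposition q) (T : X →L[𝕜] Y) (B : Finset κ)
    {δ : ℝ} (hδ : 0 < δ) :
    ∃ A C, B ⊆ A ∧ A ⊆ C ∧ ∃ x y, ‖x‖ ≤ 1 ∧ ‖y‖ ≤ 1 ∧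
      ‖partialProj q A (T x) - partialProj q A (T y)‖ < δ ∧
      ‖T x - partialProj q C (T x)‖ < δ ∧
      ‖T - partialProj q A ∘L T‖ - δ < ‖T x - partialProj q A (T x)‖ ∧
      ‖T - partialProj q A ∘L T‖ - δ < ‖T y - partialProj q C (T y)‖ := by
  obtain ⟨A, hBA, hA⟩ := hq.exists_superset_forall_exists_lt_norm T B hδ
  choose u hu hlt using hA
  have hcompact : IsCompactOperator (partialProj q A ∘L T) :=
    (isCompactOperator_partialProj hq.isCompactOperator A).comp_clm T
  obtain ⟨D, hD, hAD⟩ := ((frequently_frequently_norm_map_sub_lt (l := Filter.atTop) hcompact hu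
    hδ).and_eventually (Filter.eventually_ge_atTop A)).exists
  have htail : ∀ᶠ C in Filter.atTop, ‖T (u D) - partialProj q C (T (u D))‖ < δ := by
    filter_upwards [hq.tendsto_partialProj (T (u D)) (Metric.ball_mem_nhds _ hδ)] with C hC
    rwa [Set.mem_preimage, mem_ball_iff_norm'] at hC
  obtain ⟨C, ⟨hDC, hAC⟩, hC⟩ :=
    ((hD.and_eventually (Filter.eventually_ge_atTop A)).and_eventually htail).exists
  exact ⟨A, C, hBA, hAC, u D, u C, hu D, hu C, hDC, hC,
    (hlt D).trans_le (hq.norm_sub_partialProj_anti hAD _), hlt C⟩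

theorem exists_norm_partialProj_map_le (hq : IsL1Decomposition q) {T : X →L[𝕜] Y} {r : ℝ}
    (hr : r < essNorm T) (B : Finset κ) {ε : ℝ} (hε : 0 < ε) :
    ∃ x, ‖x‖ ≤ 1 ∧ ‖partialProj q B (T x)‖ ≤ ε ∧ r < ‖T x - partialProj q B (T x)‖ := by
  obtain ⟨δ, hδ, hδ'⟩ := exists_between (lt_min hε (div_pos (sub_pos.2 hr) three_pos))
  obtain ⟨hδε, hδr⟩ := lt_min_iff.1 hδ'
  obtain ⟨A, C, hBA, hAC, x, y, hx, hy, hxy, hxC, hxA, hyC⟩ := hq.exists_superset_exists_pair T B hδ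
  have hess : essNorm T ≤ ‖T - partialProj q A ∘L T‖ := by
    rw [← essNorm_sub_of_isCompactOperator T (S := partialProj q A ∘L T)
      ((isCompactOperator_partialProj hq.isCompactOperator A).comp_clm T)]
    exact essNorm_le_norm _
  have hyA : ‖T y - partialProj q A (T y)‖ ≤ ‖T - partialProj q A ∘L T‖ :=
    (T - partialProj q A ∘L T).unit_le_opNorm y hy
  have hfar := hq.norm_add_norm_le_norm_sub_add C (T x - partialProj q A (T x))
    (T y - partialProj q A (T y))
  have hsplit := hq.norm_sub_partialProj C (T y - partialProj q A (T y))
  rw [sub_partialProj_sub_partialProj_of_subset hq.toOrthogonalIdempotents hAC] at hfar hsplit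
  have hhalf : ∀ z : Y, ‖(2 : 𝕜)⁻¹ • z‖ = ‖z‖ / 2 := fun z => by
    rw [norm_smul, norm_inv, RCLike.norm_ofNat, inv_mul_eq_div]
  -- `T x` and `T y` almost agree on `A` and are almost disjointly supported off `A`.
  refine ⟨(2 : 𝕜)⁻¹ • (x - y), ?_, ?_, ?_⟩
  · rw [norm_smul, norm_inv, RCLike.norm_ofNat]
    linarith [norm_sub_le x y]
  · refine (hq.norm_partialProj_mono hBA _).trans ?_
    rw [map_smul, map_smul, hhalf, map_sub, map_sub]
    linarith
  · refine lt_of_lt_of_le ?_ (hq.norm_sub_partialProj_anti hBA _)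
    rw [map_smul, map_smul, ← smul_sub, hhalf, map_sub, map_sub, sub_sub_sub_comm]
    linarith

theorem exists_isGliding (hq : IsL1Decomposition q) {T : X →L[𝕜] Y} {K η : ℝ} (hK : 0 < K)
    (hT : K⁻¹ < essNorm T) (hη : 0 < η) : ∃ h : ℕ → Hump T q K, Hump.IsGliding η h := by
  obtain ⟨h, hh, -⟩ := Hump.exists_isGliding hq.toIsCompactDecomposition hK hη
    (fun _ => True) (fun _ _ => True) (T := T) fun s _ δ hδ B hB => by
      obtain ⟨x, hx, hBx, hTx⟩ := hq.exists_norm_partialProj_map_le hT B (div_pos hδ hK)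
      refine ⟨x, hx, trivial, fun a ha => ⟨trivial, ?_⟩, hTx⟩
      calc ‖a.fnl (T x)‖ ≤ K * ‖partialProj q a.blocks (T x)‖ := a.norm_fnl_le _
        _ ≤ K * ‖partialProj q B (T x)‖ := by
          gcongr
          exact hq.norm_partialProj_mono (hB a ha) _
        _ ≤ K * (δ / K) := by gcongr
        _ = δ := mul_div_cancel₀ δ hK.ne'
  exact ⟨h, hh⟩

theorem identityFactors [CompleteSpace X] (hq : IsL1Decomposition q) :
    IdentityFactors 𝕜 (L1 𝕜 ℕ) X Y := by
  refine .of_exists_factorization fun T K hK hT => ?_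
  have hK0 : 0 < K := by linarith
  obtain ⟨h, hh⟩ := hq.exists_isGliding hK0 hT (sub_pos.2 (inv_lt_one_of_one_lt₀ hK))
  obtain ⟨U, hU, heU⟩ := L1.exists_clm_apply_eq (g := fun n => (h n).fnl) hK0.le fun s y =>
    calc ∑ n ∈ s, ‖(h n).fnl y‖ ≤ ∑ n ∈ s, K * ‖partialProj q (h n).blocks y‖ :=
          Finset.sum_le_sum fun n _ => (h n).norm_fnl_le y
      _ = K * ∑ n ∈ s, ‖partialProj q (h n).blocks y‖ := (Finset.mul_sum _ _ _).symm
      _ ≤ K * ‖y‖ := by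
        gcongr
        exact hq.sum_norm_partialProj_le s (fun m _ n _ hmn => hh.disjoint_blocks hmn) y
  obtain ⟨V, hV, hVa⟩ := L1.exists_clm_hasSum_smul (𝕜 := 𝕜) fun n => (h n).norm_vec_le
  exact hh.exists_factorization L1.isBetweenSupAndL1 hK hU heU hV hVa

end IsL1Decomposition

end L1Decomposition

section DirectSums

variable {𝕜 ι : Type*} [RCLike 𝕜] {F : ι → Type*} [∀ i, NormedAddCommGroup (F i)]
  [∀ i, NormedSpace 𝕜 (F i)]

theorem isCompactOperator_comp_of_finiteDimensional {X Y G : Type*} [NormedAddCommGroup X]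
    [NormedSpace 𝕜 X] [NormedAddCommGroup Y] [NormedSpace 𝕜 Y] [NormedAddCommGroup G]
    [NormedSpace 𝕜 G] [FiniteDimensional 𝕜 G] (S : G →L[𝕜] Y) (T : X →L[𝕜] G) :
    IsCompactOperator (S ∘L T) :=
  have := FiniteDimensional.proper_rclike 𝕜 G
  (isCompactOperator_of_locallyCompactSpace_rng S).comp_clm T

theorem orthogonalIdempotents_comp {X : Type*} [NormedAddCommGroup X] [NormedSpace 𝕜 X]
    {σ : ∀ i, F i →L[𝕜] X} {π : ∀ i, X →L[𝕜] F i} (hself : ∀ i y, π i (σ i y) = y)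
    (hne : ∀ i j y, i ≠ j → π i (σ j y) = 0) : OrthogonalIdempotents fun i => σ i ∘L π i where
  idem i := ContinuousLinearMap.ext fun x => congrArg (σ i) (hself i (π i x))
  ortho i j hij := ContinuousLinearMap.ext fun x =>
    (congrArg (σ i) (hne i j (π j x) hij)).trans (map_zero (σ i))

section C0

open Classical in
variable (𝕜 F) in
/-- The inclusion of the `i`-th summand into a `c₀`-direct sum; its counterpart for `ℓ₁`-direct sums
is `lp.singleContinuousLinearMap`. -/
def C0Sum.singleCLM (i : ι) : F i →L[𝕜] C0Sum 𝕜 F :=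
  (lp.singleContinuousLinearMap 𝕜 F ∞ i).codRestrict (c0Submodule 𝕜 F) fun y _ hε =>
    (Set.finite_singleton i).subset fun j hj => by_contra fun hji => hε.not_ge <| by
      rw [Set.mem_ofPred_eq, lp.singleContinuousLinearMap_apply] at hj
      rwa [lp.single_apply_ne _ _ _ hji, norm_zero] at hj

theorem C0Sum.evalCLM_singleCLM_self (i : ι) (y : F i) : evalCLM 𝕜 F i (singleCLM 𝕜 F i y) = y :=
  by classical exact lp.single_apply_self ∞ i y

theorem C0Sum.evalCLM_singleCLM_of_ne (i j : ι) (y : F j) (h : i ≠ j) :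
    evalCLM 𝕜 F i (singleCLM 𝕜 F j y) = 0 := by
  classical exact lp.single_apply_ne ∞ j y h

theorem C0Sum.norm_singleCLM (i : ι) (y : F i) : ‖singleCLM 𝕜 F i y‖ = ‖y‖ := by
  classical exact lp.norm_single (by simp) i y

theorem C0Sum.hasSum_singleCLM (x : C0Sum 𝕜 F) :
    HasSum (fun i => singleCLM 𝕜 F i (evalCLM 𝕜 F i x)) x := by
  classical
  refine Metric.tendsto_atTop.2 fun ε hε => ?_
  have hfin := x.2 (ε / 2) (half_pos hε)
  refine ⟨hfin.toFinset, fun A hA => ?_⟩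
  rw [dist_eq_norm']
  refine ((norm_le_iff (half_pos hε).le).2 fun i => ?_).trans_lt (half_lt_self hε)
  have heval : evalCLM 𝕜 F i (∑ j ∈ A, singleCLM 𝕜 F j (evalCLM 𝕜 F j x)) =
      if i ∈ A then evalCLM 𝕜 F i x else 0 := by
    rw [map_sum]
    split_ifs with hi
    · rw [Finset.sum_eq_single_of_mem i hi fun j _ hji => evalCLM_singleCLM_of_ne i j _ hji.symm,
        evalCLM_singleCLM_self]
    · exact Finset.sum_eq_zero fun j hj => evalCLM_singleCLM_of_ne i j _ fun h => hi (h ▸ hj)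
  rw [map_sub, heval]
  split_ifs with hi
  · simpa using (half_pos hε).le
  · rw [sub_zero]
    exact (not_le.1 fun h => hi (hA (hfin.mem_toFinset.2 h))).le

variable (𝕜 F) in
theorem C0Sum.isC0Decomposition [∀ i, FiniteDimensional 𝕜 (F i)] :
    IsC0Decomposition fun i => singleCLM 𝕜 F i ∘L evalCLM 𝕜 F i where
  toOrthogonalIdempotents := orthogonalIdempotents_comp evalCLM_singleCLM_self
    evalCLM_singleCLM_of_ne
  isCompactOperator _ := isCompactOperator_comp_of_finiteDimensional _ _
  hasSum := hasSum_singleCLM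
  norm_le_iff x r hr := (norm_le_iff hr).trans <|
    forall_congr' fun i => by rw [ContinuousLinearMap.comp_apply, norm_singleCLM]

end C0

open Classical in
variable (𝕜 F) in
theorem L1Sum.isL1Decomposition [∀ i, FiniteDimensional 𝕜 (F i)] :
    IsL1Decomposition fun i => lp.singleContinuousLinearMap 𝕜 F 1 i ∘L lp.evalCLM 𝕜 F 1 i where
  toOrthogonalIdempotents := orthogonalIdempotents_comp (fun i y => lp.single_apply_self 1 i y)
    fun _ j y h => lp.single_apply_ne 1 j y h
  isCompactOperator _ := isCompactOperator_comp_of_finiteDimensional _ _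
  hasSum x := lp.hasSum_single ENNReal.one_ne_top x
  hasSum_norm x := (hasSum_norm x).congr_fun fun i => lp.norm_single one_pos i (x i)

end DirectSums

section Products

variable {𝕜 X Y Z ι κ : Type*} [RCLike 𝕜] [NormedAddCommGroup X] [NormedSpace 𝕜 X]
  [NormedAddCommGroup Y] [NormedSpace 𝕜 Y] [NormedAddCommGroup Z] [NormedSpace 𝕜 Z]
  {p : ι → X →L[𝕜] X} {q : κ → Y →L[𝕜] Y}

theorem IsCompactDecomposition.sumElim (hp : IsCompactDecomposition p)
    (hq : IsCompactDecomposition q) {σ₁ : X →L[𝕜] Z} {σ₂ : Y →L[𝕜] Z} {π₁ : Z →L[𝕜] X}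
    {π₂ : Z →L[𝕜] Y} (h₁₁ : ∀ x, π₁ (σ₁ x) = x) (h₂₂ : ∀ y, π₂ (σ₂ y) = y)
    (h₁₂ : ∀ y, π₁ (σ₂ y) = 0) (h₂₁ : ∀ x, π₂ (σ₁ x) = 0)
    (hadd : ∀ z, σ₁ (π₁ z) + σ₂ (π₂ z) = z) :
    IsCompactDecomposition
      (Sum.elim (fun i => σ₁ ∘L p i ∘L π₁) fun j => σ₂ ∘L q j ∘L π₂) where
  idem := by
    rintro (i | j) <;> ext z
    · simpa [h₁₁] using congrArg σ₁ (DFunLike.congr_fun (hp.idem i) (π₁ z))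
    · simpa [h₂₂] using congrArg σ₂ (DFunLike.congr_fun (hq.idem j) (π₂ z))
  ortho := by
    rintro (i | i) (j | j) hij <;> ext z
    · simpa [h₁₁] using congrArg σ₁ (DFunLike.congr_fun (hp.ortho (ne_of_apply_ne _ hij)) (π₁ z))
    · simp [h₁₂]
    · simp [h₂₁]
    · simpa [h₂₂] using congrArg σ₂ (DFunLike.congr_fun (hq.ortho (ne_of_apply_ne _ hij)) (π₂ z))
  isCompactOperator := by
    rintro (i | j)
    · exact ((hp.isCompactOperator i).comp_clm π₁).clm_comp σ₁
    · exact ((hq.isCompactOperator j).comp_clm π₂).clm_comp σ₂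
  hasSum z := by
    have hsum := HasSum.sum (f := fun k => Sum.elim (fun i => σ₁ ∘L p i ∘L π₁)
      (fun j => σ₂ ∘L q j ∘L π₂) k z) (σ₁.hasSum (hp.hasSum (π₁ z))) (σ₂.hasSum (hq.hasSum (π₂ z)))
    rwa [hadd] at hsum

theorem IsC0Decomposition.prod (hp : IsC0Decomposition p) (hq : IsC0Decomposition q) :
    IsC0Decomposition (X := X × Y) (Sum.elim
      (fun i => ContinuousLinearMap.inl 𝕜 X Y ∘L p i ∘L ContinuousLinearMap.fst 𝕜 X Y)
      fun j => ContinuousLinearMap.inr 𝕜 X Y ∘L q j ∘L ContinuousLinearMap.snd 𝕜 X Y) where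
  toIsCompactDecomposition := hp.toIsCompactDecomposition.sumElim hq.toIsCompactDecomposition
    (fun _ => rfl) (fun _ => rfl) (fun _ => rfl) (fun _ => rfl) (by simp)
  norm_le_iff z r hr := by
    rw [norm_prod_le_iff, hp.norm_le_iff _ r hr, hq.norm_le_iff _ r hr, Sum.forall]
    simp [Prod.norm_def]

theorem IsL1Decomposition.prod (hp : IsL1Decomposition p) (hq : IsL1Decomposition q) :
    IsL1Decomposition (Y := WithLp 1 (X × Y)) (Sum.elim
      (fun i => ((WithLp.prodContinuousLinearEquiv 1 𝕜 X Y).symm ∘L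
        ContinuousLinearMap.inl 𝕜 X Y) ∘L p i ∘L WithLp.fstL 1 𝕜 X Y)
      fun j => ((WithLp.prodContinuousLinearEquiv 1 𝕜 X Y).symm ∘L
        ContinuousLinearMap.inr 𝕜 X Y) ∘L q j ∘L WithLp.sndL 1 𝕜 X Y) where
  toIsCompactDecomposition := hp.toIsCompactDecomposition.sumElim hq.toIsCompactDecomposition
    (fun _ => rfl) (fun _ => rfl) (fun _ => rfl) (fun _ => rfl) fun z =>
      WithLp.ofLp_injective 1 (Prod.ext (by simp) (by simp))
  hasSum_norm z := by
    rw [WithLp.prod_norm_eq_of_L1]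
    refine HasSum.sum ?_ ?_
    · exact (hp.hasSum_norm z.fst).congr_fun fun i => WithLp.norm_toLp_fst 1 X Y (p i z.fst)
    · exact (hq.hasSum_norm z.snd).congr_fun fun j => WithLp.norm_toLp_snd 1 X Y (q j z.snd)

end Products

section NotCompact

variable {𝕜 E : Type*} [RCLike 𝕜] [NormedAddCommGroup E] [NormedSpace 𝕜 E]

theorem not_isCompactOperator_id_of_dual_eq_zero_one {ι : Type*} [Infinite ι] (v : ι → E)
    (φ : ι → StrongDual 𝕜 E) (hself : ∀ i, φ i (v i) = 1) (hne : ∀ i j, i ≠ j → φ i (v j) = 0) :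
    ¬ IsCompactOperator (ContinuousLinearMap.id 𝕜 E) := fun hid =>
  have : FiniteDimensional 𝕜 E := FiniteDimensional.of_isCompactOperator_id hid
  (LinearIndependent.of_pairwise_dual_eq_zero_one v (fun i => (φ i : E →ₗ[𝕜] 𝕜)) hne
    hself).finite.false

variable (𝕜) (Γ : Type*) [Infinite Γ]

theorem C0.not_isCompactOperator_id : ¬ IsCompactOperator (ContinuousLinearMap.id 𝕜 (C0 𝕜 Γ)) :=
  not_isCompactOperator_id_of_dual_eq_zero_one (fun i => C0Sum.singleCLM 𝕜 _ i 1)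
    (fun i => C0Sum.evalCLM 𝕜 _ i) (fun i => C0Sum.evalCLM_singleCLM_self i 1)
    fun i j => C0Sum.evalCLM_singleCLM_of_ne i j 1

open Classical in
theorem L1.not_isCompactOperator_id : ¬ IsCompactOperator (ContinuousLinearMap.id 𝕜 (L1 𝕜 Γ)) :=
  not_isCompactOperator_id_of_dual_eq_zero_one (fun i => lp.single 1 i (1 : 𝕜))
    (fun i => lp.evalCLM 𝕜 _ 1 i) (fun i => lp.single_apply_self 1 i 1)
    fun _ j => lp.single_apply_ne 1 j 1

end NotCompact

section Calkin

variable {𝕜 E X : Type*} [RCLike 𝕜] [NormedAddCommGroup E] [NormedSpace 𝕜 E]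
  [NormedAddCommGroup X] [NormedSpace 𝕜 X] {U : X →L[𝕜] E} {T : X →L[𝕜] X} {V : E →L[𝕜] X}

theorem isIdempotentElem_comp_of_comp_eq_id (h : U ∘L T ∘L V = ContinuousLinearMap.id 𝕜 E) :
    IsIdempotentElem (V ∘L U ∘L T) :=
  ContinuousLinearMap.ext fun x => congrArg V (DFunLike.congr_fun h (U (T x)))

theorem not_isCompactOperator_comp_of_comp_eq_id
    (hE : ¬ IsCompactOperator (ContinuousLinearMap.id 𝕜 E))
    (h : U ∘L T ∘L V = ContinuousLinearMap.id 𝕜 E) : ¬ IsCompactOperator (V ∘L U ∘L T) := by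
  intro hcompact
  have hid : (U ∘L T) ∘L (V ∘L U ∘L T) ∘L V = ContinuousLinearMap.id 𝕜 E := by
    ext x
    have hx : ∀ x, U (T (V x)) = x := DFunLike.congr_fun h
    simp [hx]
  exact hE (hid ▸ (hcompact.comp_clm V).clm_comp (U ∘L T))

theorem IdentityFactors.hasIFP [CompleteSpace X] (h : IdentityFactors 𝕜 E X X)
    (hE : ¬ IsCompactOperator (ContinuousLinearMap.id 𝕜 E)) {C : ℝ} (hC : 1 < C) :
    HasIFP C (Calkin 𝕜 X) := by
  intro a ha
  obtain ⟨T, rfl⟩ := Submodule.Quotient.mk_surjective _ a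
  have hmk_eq_zero (S : X →L[𝕜] X) :
      (Submodule.Quotient.mk S : Calkin 𝕜 X) = 0 ↔ IsCompactOperator S :=
    Submodule.Quotient.mk_eq_zero (compactIdeal 𝕜 X)
  have hT : ¬ IsCompactOperator T := fun hT => by
    rw [(hmk_eq_zero T).2 hT, norm_zero] at ha
    exact zero_ne_one ha
  obtain ⟨U, V, hUV, hnorm⟩ := h T hT ha C hC
  refine ⟨Submodule.Quotient.mk (V ∘L U), 1, ?_, ?_, ?_⟩
  · calc ‖(Submodule.Quotient.mk (V ∘L U) : Calkin 𝕜 X)‖ * ‖(1 : Calkin 𝕜 X)‖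
        ≤ ‖V ∘L U‖ * ‖ContinuousLinearMap.id 𝕜 X‖ := by
          gcongr <;> exact Submodule.Quotient.norm_mk_le _ _
      _ ≤ (‖V‖ * ‖U‖) * 1 := by
          gcongr
          exacts [V.opNorm_comp_le U, ContinuousLinearMap.norm_id_le]
      _ ≤ C := by rwa [mul_one, mul_comm]
  · rw [mul_one]
    exact (hmk_eq_zero (V ∘L U ∘L T)).not.2 (not_isCompactOperator_comp_of_comp_eq_id hE hUV)
  · rw [mul_one]
    exact (isIdempotentElem_comp_of_comp_eq_id hUV).map (Ideal.Quotient.mk (compactIdeal 𝕜 X))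

end Calkin

section Incompressible

theorem one_le_norm_of_isIdempotentElem {B : Type*} [NonUnitalNormedRing B]
    {e : B} (he : IsIdempotentElem e) (hne : e ≠ 0) : 1 ≤ ‖e‖ :=
  le_of_mul_le_mul_right (by simpa [he.eq] using norm_mul_le e e) (norm_pos_iff.2 hne)

variable {𝕜 A B : Type*} [RCLike 𝕜] [NonUnitalNormedRing A] [NormedSpace 𝕜 A]
  [NonUnitalNormedRing B] [NormedSpace 𝕜 B]

theorem HasIFP.one_le_mul_norm_map {C : ℝ} (h : HasIFP C A) (φ : A →L[𝕜] B)
    (hmul : ∀ a b, φ (a * b) = φ a * φ b) (hinj : Function.Injective φ) {a : A} (ha : ‖a‖ = 1) :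
    1 ≤ C * ‖φ‖ ^ 2 * ‖φ a‖ := by
  obtain ⟨b, c, hbc, hne, hidem⟩ := h a ha
  calc 1 ≤ ‖φ (b * a * c)‖ := one_le_norm_of_isIdempotentElem
        ((hmul _ _).symm.trans (congrArg φ hidem.eq)) ((map_ne_zero_iff φ hinj).2 hne)
    _ ≤ ‖φ b‖ * ‖φ a‖ * ‖φ c‖ := by
      rw [hmul, hmul]
      exact norm_mul₃_le
    _ ≤ (‖φ‖ * ‖b‖) * ‖φ a‖ * (‖φ‖ * ‖c‖) := by
      gcongr <;> exact φ.le_opNorm _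
    _ = (‖b‖ * ‖c‖) * (‖φ‖ ^ 2 * ‖φ a‖) := by ring
    _ ≤ C * (‖φ‖ ^ 2 * ‖φ a‖) := by gcongr
    _ = C * ‖φ‖ ^ 2 * ‖φ a‖ := by ring

theorem HasIFP.uniformlyIncompressible.{z} {C : ℝ} (hC : 0 < C) (h : HasIFP C A) :
    UniformlyIncompressible.{z} 𝕜 A := by
  refine ⟨fun t => (C * t ^ 2)⁻¹, fun t ht => by positivity, fun B _ _ _ _ φ hmul hinj a => ?_⟩
  obtain rfl | ha := eq_or_ne a 0
  · simp
  have hbound := h.one_le_mul_norm_map φ hmul hinj (norm_smul_inv_norm (𝕜 := 𝕜) ha)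
  have hφ : 0 < ‖φ‖ := norm_pos_iff.2 fun h => ha (hinj (by simp [h]))
  rw [map_smul, norm_smul, norm_inv, RCLike.norm_ofReal, abs_norm] at hbound
  rw [inv_mul_le_iff₀ (by positivity)]
  calc ‖a‖ ≤ ‖a‖ * (C * ‖φ‖ ^ 2 * (‖a‖⁻¹ * ‖φ a‖)) := le_mul_of_one_le_right (norm_nonneg a) hbound
    _ = C * ‖φ‖ ^ 2 * ‖φ a‖ := by field_simp [norm_ne_zero_iff.2 ha]

end Incompressible

end CalkinIFP

end

theorem mainTheorem5_general {𝕜 : Type u} [RCLike 𝕜] {Γ : Type v₁} {Ξ : Type v₂}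
    (F : Γ → Type v₃) (G : Ξ → Type v₄)
    [∀ γ, NormedAddCommGroup (F γ)] [∀ γ, NormedSpace 𝕜 (F γ)] [∀ γ, FiniteDimensional 𝕜 (F γ)]
    [∀ ξ, NormedAddCommGroup (G ξ)] [∀ ξ, NormedSpace 𝕜 (G ξ)] [∀ ξ, FiniteDimensional 𝕜 (G ξ)] :
    CalkinIFP.IdentityFactors 𝕜 (CalkinIFP.C0 𝕜 ℕ) (CalkinIFP.C0Sum 𝕜 F) (CalkinIFP.C0Sum 𝕜 G) ∧
    (∀ (X : Type v₅) [NormedAddCommGroup X] [NormedSpace 𝕜 X] [CompleteSpace X],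
      CalkinIFP.IdentityFactors 𝕜 (CalkinIFP.L1 𝕜 ℕ) X (CalkinIFP.L1Sum G)) ∧
    (∀ [∀ γ, CompleteSpace (F γ)] [∀ ξ, CompleteSpace (G ξ)],
      let X₀ := CalkinIFP.C0Sum 𝕜 F × CalkinIFP.C0Sum 𝕜 G
      let X₁ := WithLp 1 (CalkinIFP.L1Sum F × CalkinIFP.L1Sum G)
      (CalkinIFP.IdentityFactors 𝕜 (CalkinIFP.C0 𝕜 ℕ) X₀ X₀ ∧
        (∀ C : ℝ, 1 < C → CalkinIFP.HasIFP C (CalkinIFP.Calkin 𝕜 X₀)) ∧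
        CalkinIFP.UniformlyIncompressible.{w} 𝕜 (CalkinIFP.Calkin 𝕜 X₀)) ∧
      (CalkinIFP.IdentityFactors 𝕜 (CalkinIFP.L1 𝕜 ℕ) X₁ X₁ ∧
        (∀ C : ℝ, 1 < C → CalkinIFP.HasIFP C (CalkinIFP.Calkin 𝕜 X₁)) ∧
        CalkinIFP.UniformlyIncompressible.{w} 𝕜 (CalkinIFP.Calkin 𝕜 X₁))) := by
  have hF := CalkinIFP.C0Sum.isC0Decomposition 𝕜 F
  have hG := CalkinIFP.C0Sum.isC0Decomposition 𝕜 G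
  have hF₁ := CalkinIFP.L1Sum.isL1Decomposition 𝕜 F
  have hG₁ := CalkinIFP.L1Sum.isL1Decomposition 𝕜 G
  refine ⟨?_, fun X => hG₁.identityFactors, fun {_ _} => ⟨?_, ?_⟩⟩
  · have : ∀ γ, CompleteSpace (F γ) := fun γ => FiniteDimensional.complete 𝕜 (F γ)
    exact hF.identityFactors hG
  · have hfactors := (hF.prod hG).identityFactors (hF.prod hG)
    have hifp {C : ℝ} := hfactors.hasIFP (CalkinIFP.C0.not_isCompactOperator_id 𝕜 ℕ) (C := C)
    exact ⟨hfactors, fun C => hifp, (hifp one_lt_two).uniformlyIncompressible two_pos⟩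
  · have hfactors := (hF₁.prod hG₁).identityFactors
      (X := WithLp 1 (CalkinIFP.L1Sum F × CalkinIFP.L1Sum G))
    have hifp {C : ℝ} := hfactors.hasIFP (CalkinIFP.L1.not_isCompactOperator_id 𝕜 ℕ) (C := C)
    exact ⟨hfactors, fun C => hifp, (hifp one_lt_two).uniformlyIncompressible two_pos⟩

theorem mainTheorem5 {𝕜 : Type u} [RCLike 𝕜] :
    (∀ (Γ : Type v₁) (Ξ : Type v₂) [Infinite Γ] [Infinite Ξ] (F : Γ → Type v₃) (G : Ξ → Type v₄)
      [∀ γ, NormedAddCommGroup (F γ)] [∀ γ, NormedSpace 𝕜 (F γ)]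
      [∀ γ, FiniteDimensional 𝕜 (F γ)] [∀ γ, Nontrivial (F γ)]
      [∀ ξ, NormedAddCommGroup (G ξ)] [∀ ξ, NormedSpace 𝕜 (G ξ)]
      [∀ ξ, FiniteDimensional 𝕜 (G ξ)] [∀ ξ, Nontrivial (G ξ)],
      CalkinIFP.IdentityFactors 𝕜 (CalkinIFP.C0 𝕜 ℕ)
          (CalkinIFP.C0Sum 𝕜 F) (CalkinIFP.C0Sum 𝕜 G) ∧
        CalkinIFP.IdentityFactors 𝕜 (CalkinIFP.L1 𝕜 ℕ)
          (CalkinIFP.L1Sum F) (CalkinIFP.L1Sum G)) ∧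
    (∀ Γ : Type v₅,
      (CalkinIFP.IdentityFactors 𝕜 (CalkinIFP.C0 𝕜 ℕ)
          (CalkinIFP.HilbertC0 𝕜 Γ) (CalkinIFP.HilbertC0 𝕜 Γ) ∧
        (∀ C : ℝ, 1 < C → CalkinIFP.HasIFP C (CalkinIFP.Calkin 𝕜 (CalkinIFP.HilbertC0 𝕜 Γ))) ∧
        CalkinIFP.UniformlyIncompressible.{w} 𝕜
          (CalkinIFP.Calkin 𝕜 (CalkinIFP.HilbertC0 𝕜 Γ))) ∧
      (CalkinIFP.IdentityFactors 𝕜 (CalkinIFP.L1 𝕜 ℕ)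
          (CalkinIFP.HilbertL1 𝕜 Γ) (CalkinIFP.HilbertL1 𝕜 Γ) ∧
        (∀ C : ℝ, 1 < C → CalkinIFP.HasIFP C (CalkinIFP.Calkin 𝕜 (CalkinIFP.HilbertL1 𝕜 Γ))) ∧
        CalkinIFP.UniformlyIncompressible.{w} 𝕜
          (CalkinIFP.Calkin 𝕜 (CalkinIFP.HilbertL1 𝕜 Γ)))) := by
  refine ⟨fun Γ Ξ _ _ F G _ _ _ _ _ _ _ _ => ?_, fun Γ =>
    (mainTheorem5_general.{w, u, 0, v₅, u, u, 0} (𝕜 := 𝕜) _ _).2.2⟩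
  have : ∀ γ, CompleteSpace (F γ) := fun γ => FiniteDimensional.complete 𝕜 (F γ)
  have h := mainTheorem5_general.{w, u, v₁, v₂, v₃, v₄, max v₁ v₃} (𝕜 := 𝕜) F G
  exact ⟨h.1, h.2.1 _⟩
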